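/- Let $\mathbb T=[-1,1)$ with periodic boundary condition and let $\sigma>0$, $0<T\le\infty$. Consider a solution $(u,p,\mathcal D_t)$ on $[0,T)$ of the two-dimensional incompressible free boundary Euler equations with surface tension $$\partial_t u+u\cdot\nabla u+\nabla p=0,\qquad \nabla\cdot u=0\qquad\text{in }\mathcal D_t\subset\mathbb T\times(0,\infty),$$ where $\mathcal D_t$ is bounded below by the flat bottom $\Gamma_b=\mathbb T\times\{0\}$ and above by the free boundary $\Gamma_t$, with boundary conditions $$V=u\cdot\mathcal N\ \text{ and }\ p=\sigma\mathcal H\ \text{ on }\Gamma_t,\qquad u\cdot n=0\ \text{ on }\Gamma_b .$$ Here $\mathcal N$ is the outward unit normal of $\Gamma_t$, $V$ its normal velocity, $\mathcal H$ its curvature (the tangential divergence of $\mathcal N$), and $n=(0,-1)$. The initial domain is $\mathcal D_0=\mathbb T\times(0,2)$, so $\Gamma_0=\mathbb T\times\{2\}$, and the initial velocity $u(0,\cdot)$ is smooth in $\mathcal D_0$. A solution is understood in the classical sense (which includes $H^s$-solutions, $s\ge4$): there are diffeomorphisms $\Phi_t$ of $\mathbb T\times[0,2]$ onto $\overline{\mathcal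 D_t}$, jointly $C^2$ in $(t,x)\in[0,T)\times(\mathbb T\times[0,2])$, whose lifts to $\mathbb R\times[0,2]$ commute with the shift by $(2,0)$, with $\Phi_0=\mathrm{id}$, $\Phi_t(\mathbb T\times(0,2))=\mathcal D_t$, $\Phi_t(\mathbb T\times\{2\})=\Gamma_t\subset\mathbb T\times(0,\infty)$ and $\Phi_t(\Gamma_b)=\Gamma_b$; the velocity $u$ is $C^1$ in $(t,x)$ up to the boundary on $\{(t,x):0\le t<T,\ x\in\overline{\mathcal D_t}\}$; and $p(t,\cdot)$ is $C^1$ on $\overline{\mathcal D_t}$ for each $t\in[0,T)$. ($\Gamma_t$ need not be a graph.) Let $K(t)=\frac12\int_{\mathcal D_t}|u(t,x)|^2\,dx$ be the kinetic energy. If $K(0)\le\sigma/20$, then $$\Gamma_t\subset\mathbb T\times\left(\tfrac32,\tfrac52\right)\quad\text{and}\quad K(t)\le K(0)\qquad\text{for all }t\in[0,T).$$ In particular this holds when $T$ is the lifespan of the solution. -/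

import Mathlib

open Set
open scoped ContDiff

noncomputable section

namespace CapillaryWaves

/-! Everything on `𝕋 × ℝ`, with `𝕋 = [-1,1)` periodic, is written on the universal cover `ℝ × ℝ`:
sets are invariant under, and fields are periodic with respect to, the shift by `period`.
Since `ℝ × ℝ` carries the sup norm in Mathlib, Euclidean lengths and inner products of vectors
are written out in coordinates. -/

/-- One period `2` in the horizontal direction. -/
def period : ℝ × ℝ := (2, 0)

/-- The open strip `𝕋 × (0,2)` (on the cover): the initial fluid domain. -/
def strip : Set (ℝ × ℝ) := {x | 0 < x.2 ∧ x.2 < 2}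

/-- The closed strip `𝕋 × [0,2]` (on the cover). -/
def closedStrip : Set (ℝ × ℝ) := {x | 0 ≤ x.2 ∧ x.2 ≤ 2}

/-- The time interval `[0,T)`, where `T` may be `+∞`. -/
def timeInterval (T : EReal) : Set ℝ := {t | 0 ≤ t ∧ (t : EReal) < T}

/-- Euclidean inner product of two plane vectors. -/
def dot (v w : ℝ × ℝ) : ℝ := v.1 * w.1 + v.2 * w.2

/-- The fluid domain `𝒟_t`. -/
def fluidDomain (Φ : ℝ → ℝ × ℝ → ℝ × ℝ) (t : ℝ) : Set (ℝ × ℝ) := Φ t '' strip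

/-- The natural parametrization `a ↦ Φ_t(a,2)` of the free boundary. -/
def surfaceCurve (Φ : ℝ → ℝ × ℝ → ℝ × ℝ) (t : ℝ) : ℝ → ℝ × ℝ := fun a => Φ t (a, 2)

/-- The free boundary `Γ_t`. -/
def freeBoundary (Φ : ℝ → ℝ × ℝ → ℝ × ℝ) (t : ℝ) : Set (ℝ × ℝ) := range (surfaceCurve Φ t)

/-- A moving fluid domain on the time interval `[0,T)` starting from the flat one: a `C²` family of
diffeomorphisms `Φ_t` of `𝕋 × [0,2]` onto closed regions of `𝕋 × [0,∞)`, with `Φ_0 = id`, which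
map the bottom `𝕋 × {0}` to itself. The maps `Φ_t` serve only to describe
`𝒟_t = Φ_t(𝕋 × (0,2))` and `Γ_t = Φ_t(𝕋 × {2})`; they need not follow fluid particles, and
`Γ_t` need not be a graph. -/
structure IsMovingDomain (T : EReal) (Φ : ℝ → ℝ × ℝ → ℝ × ℝ) : Prop where
  contDiffOn : ContDiffOn ℝ 2 (fun q : ℝ × (ℝ × ℝ) => Φ q.1 q.2) (timeInterval T ×ˢ closedStrip)
  initial : ∀ x ∈ closedStrip, Φ 0 x = x
  periodic : ∀ t ∈ timeInterval T, ∀ x ∈ closedStrip, Φ t (x + period) = Φ t x + period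
  injOn : ∀ t ∈ timeInterval T, InjOn (Φ t) closedStrip
  det_ne_zero : ∀ t ∈ timeInterval T, ∀ x ∈ closedStrip,
    (fderivWithin ℝ (Φ t) closedStrip x).det ≠ 0
  bottom : ∀ t ∈ timeInterval T, ∀ a : ℝ, (Φ t (a, 0)).2 = 0
  above_bottom : ∀ t ∈ timeInterval T, ∀ x ∈ closedStrip, 0 < x.2 → 0 < (Φ t x).2

/-- The unit normal at the point `γ a` of a regular plane curve, obtained by turning the unit
tangent by a right angle counterclockwise. For `γ = surfaceCurve Φ t` (which runs from left to
right with the fluid on its right-hand side) it is the outward unit normal `𝒩`. -/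
def unitNormal (γ : ℝ → ℝ × ℝ) (a : ℝ) : ℝ × ℝ :=
  (-(deriv γ a).2 / √(dot (deriv γ a) (deriv γ a)),
    (deriv γ a).1 / √(dot (deriv γ a) (deriv γ a)))

/-- The (mean) curvature `ℋ` at `γ a`, that is, the tangential divergence of the normal `unitNormal`
(so `ℋ = 1/R` for a disk of fluid of radius `R`, and `ℋ = -h'' / (1 + h'²)^{3/2}` for a
graph `x₂ = h(x₁)` above the fluid). -/
def curvature (γ : ℝ → ℝ × ℝ) (a : ℝ) : ℝ :=
  ((deriv γ a).2 * (deriv (deriv γ) a).1 - (deriv γ a).1 * (deriv (deriv γ) a).2) /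
    (√(dot (deriv γ a) (deriv γ a))) ^ 3

/-- The closed space-time region `{(t,x) : 0 ≤ t < T, x ∈ closure 𝒟_t}` filled by the fluid. -/
def spaceTime (T : EReal) (Φ : ℝ → ℝ × ℝ → ℝ × ℝ) : Set (ℝ × (ℝ × ℝ)) :=
  {q | q.1 ∈ timeInterval T ∧ q.2 ∈ closure (fluidDomain Φ q.1)}

/-- Spatial gradient of a scalar function. -/
def grad (f : ℝ × ℝ → ℝ) (x : ℝ × ℝ) : ℝ × ℝ :=
  (fderiv ℝ f x (1, 0), fderiv ℝ f x (0, 1))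

/-- Spatial divergence of a vector field. -/
def divergence (v : ℝ × ℝ → ℝ × ℝ) (x : ℝ × ℝ) : ℝ :=
  (fderiv ℝ v x (1, 0)).1 + (fderiv ℝ v x (0, 1)).2

/-- `(u, p, 𝒟_t)` is a classical solution on `[0,T)` of the incompressible free boundary Euler
equations with surface tension `σ` and a flat bottom, with initial domain `𝕋 × (0,2)`. -/
structure IsSolution (σ : ℝ) (T : EReal) (Φ : ℝ → ℝ × ℝ → ℝ × ℝ)
    (u : ℝ → ℝ × ℝ → ℝ × ℝ) (p : ℝ → ℝ × ℝ → ℝ) : Prop where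
  movingDomain : IsMovingDomain T Φ
  /-- The velocity is `C¹` in space-time, up to the boundary. -/
  velocity_contDiffOn : ContDiffOn ℝ 1 (fun q : ℝ × (ℝ × ℝ) => u q.1 q.2) (spaceTime T Φ)
  /-- The pressure is `C¹` in space, up to the boundary. -/
  pressure_contDiffOn : ∀ t ∈ timeInterval T, ContDiffOn ℝ 1 (p t) (closure (fluidDomain Φ t))
  velocity_periodic : ∀ t ∈ timeInterval T, ∀ x ∈ closure (fluidDomain Φ t),
    u t (x + period) = u t x
  pressure_periodic : ∀ t ∈ timeInterval T, ∀ x ∈ closure (fluidDomain Φ t),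
    p t (x + period) = p t x
  /-- `∂ₜu + u·∇u + ∇p = 0` in `𝒟_t`. -/
  momentum : ∀ t ∈ timeInterval T, 0 < t → ∀ x ∈ fluidDomain Φ t,
    deriv (fun s => u s x) t + fderiv ℝ (u t) x (u t x) + grad (p t) x = 0
  /-- `∇·u = 0` in `𝒟_t`. -/
  incompressible : ∀ t ∈ timeInterval T, ∀ x ∈ fluidDomain Φ t, divergence (u t) x = 0
  /-- The normal velocity of `Γ_t` is `V = u·𝒩`. -/
  kinematic : ∀ t ∈ timeInterval T, 0 < t → ∀ a : ℝ,
    dot (deriv (fun s => surfaceCurve Φ s a) t) (unitNormal (surfaceCurve Φ t) a) =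
      dot (u t (surfaceCurve Φ t a)) (unitNormal (surfaceCurve Φ t) a)
  /-- `p = σℋ` on `Γ_t`. -/
  surfaceTension : ∀ t ∈ timeInterval T, ∀ a : ℝ,
    p t (surfaceCurve Φ t a) = σ * curvature (surfaceCurve Φ t) a
  /-- `u·n = 0` on the bottom, where `n = (0,-1)`. -/
  noFlow : ∀ t ∈ timeInterval T, ∀ a : ℝ, dot (u t (a, 0)) (0, -1) = 0

/-- The kinetic energy `½ ∫_{𝒟} |v|² dx`, the integral being over one period cell
`x₁ ∈ [-1,1)`. -/
def kineticEnergy (D : Set (ℝ × ℝ)) (v : ℝ × ℝ → ℝ × ℝ) : ℝ :=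
  1 / 2 * ∫ x in D ∩ {x | -1 ≤ x.1 ∧ x.1 < 1}, dot (v x) (v x)

end CapillaryWaves

end

/-! Kinetic energy plus `σ` times the length of one period of the free boundary is conserved
(`energy_add_length`). The length is `2` at time `0` and never less than `2`, since the curve
advances by `2` horizontally in one period. Hence `K(t) ≤ K(0)`, and with `K(0) ≤ σ/20` the length
`L` stays at most `2 + 1/20 = 41/20`.

A curve this short has little room to move vertically. The triple `40² + 9² = 41²` gives `40/41 x' +
9/41 |y'| ≤ |γ'|` for a parametrization `γ = (x, y)`, so the vertical variation `V = ∫ |y'|` is at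
most `9/20`. The integral `∫ x' y`, the area under the curve, is conserved and equals `4`
(`fluidArea_eq`). Therefore `|4 - 2 y(b)| = |∫ x' (y - y(b))| ≤ L V ≤ 369/400 < 1` for every `b`,
which is the height bound (`abs_height_sub_two_lt`). The sign of `x'` plays no role, so the curve
need not be a graph.

Both conservation laws are proved on the fixed strip, after pulling back by `Φ_t`. With `A = ∂₁Φ`,
`B = ∂₂Φ`, `W = ∂ₜΦ` and the pulled back velocity `U`, the Piola transform of a field `F` is `(cross
F B, cross A F)`; its divergence is the Jacobian times the physical divergence of `F`. Taking `F =
U` gives zero net flux through the surface (`integral_cross_vel`). Taking `F = p U + ½|U|² (U - W)`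
expresses the energy rate as minus the work of the pressure on the surface
(`integral_energyDensityDeriv`). As `p = σℋ` there, this cancels `σ` times the first variation of
length (`integral_speedDeriv`). Finally `kineticEnergy_eq` identifies the pulled back energy with
the one in the theorem. -/

noncomputable section

open Filter Topology MeasureTheory

namespace CapillaryWaves

/-! ### Directional derivatives within a set -/

section Calculus

variable {E F : Type*} [NormedAddCommGroup E] [NormedSpace ℝ E]
  [NormedAddCommGroup F] [NormedSpace ℝ F]

/-- The directional derivative of `f` within `s` in the direction `v`. -/
def pd (s : Set E) (f : E → F) (v : E) : E → F := fun q => fderivWithin ℝ f s q v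

theorem contDiffOn_pd {s : Set E} (hs : UniqueDiffOn ℝ s) {f : E → F} {m n : ℕ∞ω}
    (hf : ContDiffOn ℝ n f s) (hmn : m + 1 ≤ n) (v : E) : ContDiffOn ℝ m (pd s f v) s :=
  (hf.fderivWithin hs hmn).clm_apply contDiffOn_const

theorem continuousOn_pd {s : Set E} (hs : UniqueDiffOn ℝ s) {f : E → F}
    (hf : ContDiffOn ℝ 1 f s) (v : E) : ContinuousOn (pd s f v) s :=
  (contDiffOn_pd (m := 0) hs hf (by norm_num) v).continuousOn

/-- Symmetry of the second derivative extends from the interior to boundary points by continuity,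
which is why every point must be a limit of interior points. It is needed up to the free boundary
and the bottom. -/
theorem pd_comm {s : Set E} (hs : UniqueDiffOn ℝ s) (hcl : s ⊆ closure (interior s)) {f : E → F}
    (hf : ContDiffOn ℝ 2 f s) {q : E} (hq : q ∈ s) (v w : E) :
    pd s (pd s f v) w q = pd s (pd s f w) v q := by
  have hd : DifferentiableWithinAt ℝ (fderivWithin ℝ f s) s q :=
    (hf.fderivWithin hs (m := 1) (by norm_num)).differentiableOn (by norm_num) q hq
  have key : ∀ v w : E, pd s (pd s f v) w q = fderivWithin ℝ (fderivWithin ℝ f s) s q w v := by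
    intro v w
    have := (hd.hasFDerivWithinAt.clm_apply (hasFDerivWithinAt_const v q s)).fderivWithin (hs q hq)
    change fderivWithin ℝ (fun y => fderivWithin ℝ f s y v) s q w = _
    rw [this]
    simp
  rw [key, key]
  exact ((hf q hq).isSymmSndFDerivWithinAt (by simp) hs (hcl hq) hq) w v

theorem pd_translate {s : Set E} (hs : UniqueDiffOn ℝ s) {c : E} (hc : ∀ q ∈ s, q + c ∈ s)
    {f : E → F} {d : F} (hf : ∀ q ∈ s, f (q + c) = f q + d) (hd : DifferentiableOn ℝ f s)
    {q : E} (hq : q ∈ s) (v : E) : pd s f v (q + c) = pd s f v q := by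
  have h1 : HasFDerivWithinAt (fun x => f (x + c)) (fderivWithin ℝ f s (q + c)) s q := by
    have := (hd _ (hc q hq)).hasFDerivWithinAt.comp q
      ((hasFDerivWithinAt_id q s).add_const c) (fun x hx => hc x hx)
    simpa [Function.comp_def] using this
  have h2 : HasFDerivWithinAt (fun x => f (x + c)) (fderivWithin ℝ f s q) s q :=
    ((hd q hq).hasFDerivWithinAt.add_const d).congr (fun x hx => hf x hx) (hf q hq)
  simp only [pd]
  rw [(hs q hq).eq h1 h2]

/-- The slice of a differentiable function on a product at a fixed time. -/
theorem hasFDerivWithinAt_slice {I : Set ℝ} {C : Set E} {f : ℝ × E → F} {f' : ℝ × E →L[ℝ] F}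
    {t : ℝ} {x : E} (hf : HasFDerivWithinAt f f' (I ×ˢ C) (t, x)) (ht : t ∈ I) :
    HasFDerivWithinAt (fun y => f (t, y)) (f'.comp (ContinuousLinearMap.inr ℝ ℝ E)) C x :=
  hf.comp x (hasFDerivAt_prodMk_right t x).hasFDerivWithinAt (fun _ hy => ⟨ht, hy⟩)

theorem hasDerivAt_slice {I : Set ℝ} {C : Set E} {f : ℝ × E → F}
    {t : ℝ} {x : E} (hf : DifferentiableWithinAt ℝ f (I ×ˢ C) (t, x)) (hI : I ∈ 𝓝 t)
    (hx : x ∈ C) : HasDerivAt (fun s => f (s, x)) (pd (I ×ˢ C) f (1, 0) (t, x)) t := by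
  have h := HasFDerivWithinAt.comp (f := fun s : ℝ => (s, x)) t hf.hasFDerivWithinAt
    (hasFDerivAt_prodMk_left t x).hasFDerivWithinAt (fun _ (hy : _ ∈ I) => ⟨hy, hx⟩)
  have := (h.hasFDerivAt hI).hasDerivAt
  simpa [pd, Function.comp_def] using this

end Calculus

/-! ### Integrals depending on time -/

section ParametricIntegral

variable {X : Type*} [PseudoMetricSpace X] [MeasurableSpace X]
  [OpensMeasurableSpace X] {μ : Measure X} [IsFiniteMeasureOnCompacts μ]

theorem continuousOn_setIntegral {I : Set ℝ} (hI : IsCompact I) {K : Set X} (hK : IsCompact K)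
    (hKm : MeasurableSet K) {f : ℝ × X → ℝ} (hf : ContinuousOn f (I ×ˢ K)) :
    ContinuousOn (fun t => ∫ x in K, f (t, x) ∂μ) I := by
  obtain ⟨M, hM⟩ := (hI.prod hK).exists_bound_of_continuousOn hf
  intro t ht
  refine continuousWithinAt_of_dominated (bound := fun _ => M) ?_ ?_ ?_ ?_
  · filter_upwards [self_mem_nhdsWithin] with s hs
    exact (hf.comp (by fun_prop) (fun x hx => ⟨hs, hx⟩)).aestronglyMeasurable hKm
  · filter_upwards [self_mem_nhdsWithin] with s hs
    filter_upwards [ae_restrict_mem hKm] with x hx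
    exact hM _ ⟨hs, hx⟩
  · exact integrableOn_const hK.measure_lt_top.ne
  · filter_upwards [ae_restrict_mem hKm] with x hx
    exact ContinuousWithinAt.comp (f := fun s : ℝ => (s, x)) (hf (t, x) ⟨ht, hx⟩) (by fun_prop)
      (fun s hs => ⟨hs, hx⟩)

theorem hasDerivAt_setIntegral {I : Set ℝ} {K : Set X} (hK : IsCompact K)
    (hKm : MeasurableSet K) {f g : ℝ × X → ℝ} (hf : ContinuousOn f (I ×ˢ K))
    (hg : ContinuousOn g (I ×ˢ K))
    (hd : ∀ t, I ∈ 𝓝 t → ∀ x ∈ K, HasDerivAt (fun s => f (s, x)) (g (t, x)) t)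
    {t : ℝ} (ht : I ∈ 𝓝 t) :
    HasDerivAt (fun s => ∫ x in K, f (s, x) ∂μ) (∫ x in K, g (t, x) ∂μ) t := by
  -- The ball lies in the interior of `I`, so that `hd` applies at each of its times; compactness
  -- then gives one bound for `g`.
  obtain ⟨ε, hε, hball⟩ := Metric.nhds_basis_closedBall.mem_iff.1 (interior_mem_nhds.2 ht)
  have hJI : Metric.closedBall t ε ⊆ I := hball.trans interior_subset
  obtain ⟨M, hM⟩ := ((isCompact_closedBall t ε).prod hK).exists_bound_of_continuousOn
    (hg.mono (prod_mono hJI le_rfl))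
  have hslice : ∀ {h : ℝ × X → ℝ}, ContinuousOn h (I ×ˢ K) → ∀ s ∈ I,
      ContinuousOn (fun x => h (s, x)) K := fun hh s hs =>
    hh.comp (by fun_prop) (fun x hx => ⟨hs, hx⟩)
  refine (hasDerivAt_integral_of_dominated_loc_of_deriv_le (F := fun s x => f (s, x))
    (F' := fun s x => g (s, x)) (bound := fun _ => M)
    (Metric.closedBall_mem_nhds t hε) ?_ ?_ ?_ ?_ ?_ ?_).2
  · filter_upwards [ht] with s hs
    exact (hslice hf s hs).aestronglyMeasurable hKm
  · exact (hslice hf t (mem_of_mem_nhds ht)).integrableOn_compact' hK hKm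
  · exact (hslice hg t (mem_of_mem_nhds ht)).aestronglyMeasurable hKm
  · filter_upwards [ae_restrict_mem hKm] with x hx s hs
    exact hM (s, x) ⟨hs, hx⟩
  · exact integrableOn_const hK.measure_lt_top.ne
  · filter_upwards [ae_restrict_mem hKm] with x hx s hs
    exact hd s (mem_interior_iff_mem_nhds.1 (hball hs)) x hx

end ParametricIntegral

/-! ### The period cell and the divergence theorem -/

/-- One closed period cell of the strip. -/
def cell : Set (ℝ × ℝ) := Icc (-1, 0) (1, 2)

theorem isCompact_cell : IsCompact cell := isCompact_Icc

theorem measurableSet_cell : MeasurableSet cell := measurableSet_Icc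

theorem cell_subset : cell ⊆ closedStrip := fun _ hx => ⟨hx.1.2, hx.2.2⟩

theorem isOpen_strip : IsOpen strip :=
  (isOpen_lt continuous_const continuous_snd).inter (isOpen_lt continuous_snd continuous_const)

theorem strip_subset : strip ⊆ closedStrip := fun _ hx => ⟨hx.1.le, hx.2.le⟩

theorem closedStrip_mem_nhds {x : ℝ × ℝ} (hx : x ∈ strip) : closedStrip ∈ 𝓝 x :=
  mem_of_superset (isOpen_strip.mem_nhds hx) strip_subset

theorem closedStrip_eq : closedStrip = univ ×ˢ Icc (0 : ℝ) 2 := by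
  ext x; simp [closedStrip]

theorem convex_closedStrip : Convex ℝ closedStrip := by
  rw [closedStrip_eq]; exact convex_univ.prod (convex_Icc 0 2)

theorem strip_subset_interior : strip ⊆ interior closedStrip :=
  interior_maximal strip_subset isOpen_strip

theorem interior_closedStrip_nonempty : (interior closedStrip).Nonempty :=
  ⟨(0, 1), strip_subset_interior ⟨by norm_num, by norm_num⟩⟩

theorem uniqueDiffOn_closedStrip : UniqueDiffOn ℝ closedStrip :=
  uniqueDiffOn_convex convex_closedStrip interior_closedStrip_nonempty

theorem closedStrip_subset_closure : closedStrip ⊆ closure strip := by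
  have h : strip = univ ×ˢ Ioo (0 : ℝ) 2 := by ext x; simp [strip]
  rw [h, closure_prod_eq, closure_univ, closure_Ioo (by norm_num), closedStrip_eq]

theorem volume_strip_inter_ae_cell :
    (strip ∩ {x : ℝ × ℝ | -1 ≤ x.1 ∧ x.1 < 1} : Set (ℝ × ℝ)) =ᵐ[volume] cell := by
  have h1 : (strip ∩ {x : ℝ × ℝ | -1 ≤ x.1 ∧ x.1 < 1} : Set (ℝ × ℝ)) =
      Ico (-1 : ℝ) 1 ×ˢ Ioo (0 : ℝ) 2 := by
    ext x; simp [strip]; tauto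
  have h2 : cell = Icc (-1 : ℝ) 1 ×ˢ Icc (0 : ℝ) 2 := by
    rw [cell, Icc_prod_Icc]
  rw [h1, h2, Measure.volume_eq_prod]
  exact Measure.set_prod_ae_eq Ico_ae_eq_Icc Ioo_ae_eq_Icc

/-- By periodicity the fluxes through the two vertical sides cancel, leaving only top and bottom. -/
theorem integral_divergence_periodic {g h : ℝ × ℝ → ℝ} {g' h' : ℝ × ℝ → ℝ × ℝ →L[ℝ] ℝ}
    (hg : ∀ x ∈ closedStrip, HasFDerivWithinAt g (g' x) closedStrip x)
    (hh : ∀ x ∈ closedStrip, HasFDerivWithinAt h (h' x) closedStrip x)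
    (hper : ∀ x ∈ closedStrip, g (x + period) = g x)
    (hint : IntegrableOn (fun x => g' x (1, 0) + h' x (0, 1)) cell) :
    ∫ x in cell, (g' x (1, 0) + h' x (0, 1)) =
      (∫ a in (-1 : ℝ)..1, h (a, 2)) - ∫ a in (-1 : ℝ)..1, h (a, 0) := by
  have key := integral_divergence_prod_Icc_of_hasFDerivAt_off_countable_of_le g h g' h'
    (-1, 0) (1, 2) ⟨by norm_num, by norm_num⟩ ∅ countable_empty
    (fun x hx => ((hg x (cell_subset hx)).continuousWithinAt).mono cell_subset)
    (fun x hx => ((hh x (cell_subset hx)).continuousWithinAt).mono cell_subset)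
    (fun x hx => (hg x ⟨hx.1.2.1.le, hx.1.2.2.le⟩).hasFDerivAt
      (closedStrip_mem_nhds ⟨hx.1.2.1, hx.1.2.2⟩))
    (fun x hx => (hh x ⟨hx.1.2.1.le, hx.1.2.2.le⟩).hasFDerivAt
      (closedStrip_mem_nhds ⟨hx.1.2.1, hx.1.2.2⟩)) hint
  have hside : ∫ y in (0 : ℝ)..2, g (1, y) = ∫ y in (0 : ℝ)..2, g (-1, y) := by
    refine intervalIntegral.integral_congr fun y hy => ?_
    rw [uIcc_of_le (by norm_num)] at hy
    have := hper (-1, y) hy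
    simp only [period, Prod.mk_add_mk, add_zero] at this
    norm_num at this
    exact this
  unfold cell
  rw [key]
  simp only [hside]
  ring

/-! ### The time interval and the space-time slab -/

theorem timeInterval_mem_nhds {T : EReal} {t : ℝ} (ht : t ∈ timeInterval T) (h0 : 0 < t) :
    timeInterval T ∈ 𝓝 t := by
  have h1 : {s : ℝ | (s : EReal) < T} ∈ 𝓝 t :=
    (isOpen_Iio.preimage continuous_coe_real_ereal).mem_nhds ht.2
  filter_upwards [h1, Ioi_mem_nhds h0] with s hs hs0
  exact ⟨le_of_lt hs0, hs⟩

theorem pos_of_timeInterval_mem_nhds {T : EReal} {t : ℝ} (ht : timeInterval T ∈ 𝓝 t) : 0 < t := by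
  have : Ici (0 : ℝ) ∈ 𝓝 t := mem_of_superset ht fun _ hs => hs.1
  simpa using mem_interior_iff_mem_nhds.2 this

theorem Icc_subset_timeInterval {T : EReal} {t : ℝ} (ht : t ∈ timeInterval T) :
    Icc 0 t ⊆ timeInterval T := fun _ hs =>
  ⟨hs.1, lt_of_le_of_lt (EReal.coe_le_coe_iff.2 hs.2) ht.2⟩

theorem convex_timeInterval (T : EReal) : Convex ℝ (timeInterval T) := by
  refine OrdConnected.convex ⟨fun a ha b hb c hc => ?_⟩
  exact Icc_subset_timeInterval hb ⟨ha.1.trans hc.1, hc.2⟩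

theorem exists_mem_interior_timeInterval {T : EReal} (hT : 0 < T) :
    (interior (timeInterval T)).Nonempty := by
  obtain ⟨s, hs0, hsT⟩ := EReal.lt_iff_exists_real_btwn.1 hT
  have h0 : 0 < s := by exact_mod_cast hs0
  exact ⟨s, mem_interior_iff_mem_nhds.2 (timeInterval_mem_nhds ⟨h0.le, hsT⟩ h0)⟩

theorem zero_mem_timeInterval {T : EReal} (hT : 0 < T) : (0 : ℝ) ∈ timeInterval T :=
  ⟨le_rfl, by exact_mod_cast hT⟩

/-- The space-time slab over the reference strip. -/
def slab (T : EReal) : Set (ℝ × (ℝ × ℝ)) := timeInterval T ×ˢ closedStrip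

theorem convex_slab (T : EReal) : Convex ℝ (slab T) :=
  (convex_timeInterval T).prod convex_closedStrip

theorem interior_slab_nonempty {T : EReal} (hT : 0 < T) : (interior (slab T)).Nonempty := by
  rw [slab, interior_prod_eq]
  exact (exists_mem_interior_timeInterval hT).prod interior_closedStrip_nonempty

theorem uniqueDiffOn_slab {T : EReal} (hT : 0 < T) : UniqueDiffOn ℝ (slab T) :=
  uniqueDiffOn_convex (convex_slab T) (interior_slab_nonempty hT)

theorem slab_subset_closure {T : EReal} (hT : 0 < T) : slab T ⊆ closure (interior (slab T)) := by
  rw [(convex_slab T).closure_interior_eq_closure_of_nonempty_interior (interior_slab_nonempty hT)]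
  exact subset_closure

theorem slab_add_period {T : EReal} : ∀ q ∈ slab T, q + (0, period) ∈ slab T := by
  rintro ⟨t, x⟩ ⟨ht, hx⟩
  exact ⟨by simpa using ht, by simpa [closedStrip, period] using hx⟩

theorem slab_mem_nhds {T : EReal} {t : ℝ} {x : ℝ × ℝ} (ht : timeInterval T ∈ 𝓝 t)
    (hx : x ∈ strip) : slab T ∈ 𝓝 (t, x) := prod_mem_nhds ht (closedStrip_mem_nhds hx)

/-! ### Change of variables for periodic maps -/

/-- The half-open period cell of the plane. -/
def halfOpenCell : Set (ℝ × ℝ) := {x | -1 ≤ x.1 ∧ x.1 < 1}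

theorem measurableSet_halfOpenCell : MeasurableSet halfOpenCell :=
  (measurableSet_le measurable_const measurable_fst).inter
    (measurableSet_lt measurable_fst measurable_const)

theorem zsmul_period (n : ℤ) : n • period = ((n : ℝ) * 2, 0) := by
  simp [period]

theorem existsUnique_halfOpenCell (x : ℝ × ℝ) :
    ∃! g : AddSubgroup.zmultiples period, g +ᵥ x ∈ halfOpenCell := by
  have hinj : Function.Injective (fun n : ℤ => n • period) := by
    intro m n h
    simp only [zsmul_period, Prod.mk.injEq, and_true] at h
    exact_mod_cast mul_right_cancel₀ (by norm_num) h
  have hbij : Function.Bijective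
      (codRestrict (fun n : ℤ => n • period) (AddSubgroup.zmultiples period) fun n => ⟨n, rfl⟩) :=
    (Equiv.ofInjective (fun n : ℤ => n • period) hinj).bijective
  refine hbij.existsUnique_iff.2 ?_
  have := existsUnique_add_zsmul_mem_Ico (two_pos : (0 : ℝ) < 2) x.1 (-1)
  convert this using 2 with n
  change (n • period) + x ∈ halfOpenCell ↔ _
  rw [zsmul_period]
  simp only [halfOpenCell, mem_ofPred_eq, Prod.fst_add, mem_Ico, zsmul_eq_mul, add_comm x.1]
  norm_num

theorem isAddFundamentalDomain_halfOpenCell :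
    IsAddFundamentalDomain (AddSubgroup.zmultiples period) halfOpenCell volume :=
  IsAddFundamentalDomain.mk' measurableSet_halfOpenCell.nullMeasurableSet existsUnique_halfOpenCell

theorem zsmul_period_add_mem_strip {x : ℝ × ℝ} (n : ℤ) : n • period + x ∈ strip ↔ x ∈ strip := by
  simp [strip, period]

theorem map_zsmul_period_add {φ : ℝ × ℝ → ℝ × ℝ}
    (hper : ∀ x ∈ strip, φ (x + period) = φ x + period) (n : ℤ) :
    ∀ x ∈ strip, φ (n • period + x) = n • period + φ x := by
  induction n using Int.induction_on with
  | zero => intro x _; simp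
  | succ k ih =>
    intro x hx
    have h := hper _ ((zsmul_period_add_mem_strip k).2 hx)
    rw [ih x hx] at h
    rw [add_zsmul, one_zsmul, add_right_comm, h, add_right_comm]
  | pred k ih =>
    intro x hx
    have h := hper _ ((zsmul_period_add_mem_strip (-(k : ℤ) - 1)).2 hx)
    have e : ∀ z : ℝ × ℝ, (-(k : ℤ) - 1) • period + z + period = (-(k : ℤ)) • period + z := by
      intro z; rw [sub_zsmul, one_zsmul]; abel
    rw [e, ih x hx, ← e (φ x)] at h
    exact (add_right_cancel h).symm

/-- Change of variables over one period for a periodic diffeomorphism of the strip. The period cell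
of the image need not be the image of the period cell. -/
theorem setIntegral_image_strip {φ : ℝ × ℝ → ℝ × ℝ} {φ' : ℝ × ℝ → ℝ × ℝ →L[ℝ] ℝ × ℝ}
    (hinj : InjOn φ strip) (hper : ∀ x ∈ strip, φ (x + period) = φ x + period)
    (hd : ∀ x ∈ strip, HasFDerivAt φ (φ' x) x) {g : ℝ × ℝ → ℝ}
    (hg : ∀ y ∈ φ '' strip, g (y + period) = g y) :
    ∫ y in φ '' strip ∩ {x | -1 ≤ x.1 ∧ x.1 < 1}, g y = ∫ x in cell, |(φ' x).det| * g (φ x) := by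
  change ∫ y in φ '' strip ∩ halfOpenCell, g y = _
  set D := φ '' strip with hD
  have hcm : MeasurableSet (strip ∩ halfOpenCell) :=
    isOpen_strip.measurableSet.inter measurableSet_halfOpenCell
  have hDm : MeasurableSet D :=
    measurable_image_of_fderivWithin isOpen_strip.measurableSet
      (fun x hx => (hd x hx).hasFDerivWithinAt) hinj
  have hTm : MeasurableSet (φ '' (strip ∩ halfOpenCell)) :=
    measurable_image_of_fderivWithin hcm (fun x hx => (hd x hx.1).hasFDerivWithinAt)
      (hinj.mono inter_subset_left)
  have hDinv' : ∀ (n : ℤ) y, y ∈ D → n • period + y ∈ D := by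
    rintro n _ ⟨x, hx, rfl⟩
    exact ⟨n • period + x, (zsmul_period_add_mem_strip n).2 hx, map_zsmul_period_add hper n x hx⟩
  have hDinv : ∀ (n : ℤ) y, n • period + y ∈ D ↔ y ∈ D := by
    refine fun n y => ⟨fun h => ?_, hDinv' n y⟩
    simpa using hDinv' (-n) _ h
  have hgper : ∀ (n : ℤ) y, D.indicator g (n • period + y) = D.indicator g y := by
    intro n y
    by_cases hy : y ∈ D
    · rw [indicator_of_mem hy, indicator_of_mem ((hDinv n y).2 hy)]
      induction n using Int.induction_on with
      | zero => simp
      | succ k ih => rw [add_zsmul, one_zsmul, add_right_comm, hg _ (hDinv' k y hy), ih]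
      | pred k ih =>
        rw [← hg _ (hDinv' _ y hy), ← ih]
        congr 1
        rw [sub_zsmul, one_zsmul]; abel
    · rw [indicator_of_notMem hy, indicator_of_notMem (fun h => hy ((hDinv n y).1 h))]
  -- A second fundamental domain for the translations: the image of the reference cell inside `D`,
  -- the usual cell outside. An invariant function has the same integral over both, so the cell of
  -- the image may be traded for the image of the cell.
  set S := φ '' (strip ∩ halfOpenCell) ∪ halfOpenCell \ D with hS
  have hSfd : IsAddFundamentalDomain (AddSubgroup.zmultiples period) S volume := by
    refine IsAddFundamentalDomain.mk'
      (hTm.union (measurableSet_halfOpenCell.diff hDm)).nullMeasurableSet fun y => ?_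
    by_cases hy : y ∈ D
    · obtain ⟨x, hx, rfl⟩ := hy
      refine (existsUnique_congr fun g => ?_).1 (existsUnique_halfOpenCell x)
      obtain ⟨_, n, rfl⟩ := g
      change n • period + x ∈ halfOpenCell ↔ n • period + φ x ∈ S
      have hn := (zsmul_period_add_mem_strip n).2 hx
      rw [← map_zsmul_period_add hper n x hx]
      constructor
      · exact fun h => Or.inl ⟨_, ⟨hn, h⟩, rfl⟩
      · rintro (⟨z, ⟨hz, hz'⟩, he⟩ | ⟨_, h⟩)
        · rwa [← hinj hz hn he]
        · exact absurd ⟨_, hn, rfl⟩ h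
    · refine (existsUnique_congr fun g => ?_).1 (existsUnique_halfOpenCell y)
      obtain ⟨_, n, rfl⟩ := g
      change n • period + y ∈ halfOpenCell ↔ n • period + y ∈ S
      have hn : n • period + y ∉ D := fun h => hy ((hDinv n y).1 h)
      constructor
      · exact fun h => Or.inr ⟨h, hn⟩
      · rintro (h | h)
        · exact absurd (image_mono inter_subset_left h) hn
        · exact h.1
  have hTD : S ∩ D = φ '' (strip ∩ halfOpenCell) := by
    rw [hS, union_inter_distrib_right, sdiff_inter_self, union_empty, inter_eq_left]
    exact image_mono inter_subset_left
  calc ∫ y in D ∩ halfOpenCell, g y = ∫ y in halfOpenCell, D.indicator g y := by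
        rw [setIntegral_indicator hDm, inter_comm]
    _ = ∫ y in S, D.indicator g y := by
        refine isAddFundamentalDomain_halfOpenCell.setIntegral_eq hSfd ?_
        rintro ⟨_, n, rfl⟩ y
        exact hgper n y
    _ = ∫ y in φ '' (strip ∩ halfOpenCell), g y := by
        rw [setIntegral_indicator hDm, hTD]
    _ = ∫ x in strip ∩ halfOpenCell, |(φ' x).det| * g (φ x) :=
        integral_image_eq_integral_abs_det_fderiv_smul volume hcm
          (fun x hx => (hd x hx.1).hasFDerivWithinAt) (hinj.mono inter_subset_left) g
    _ = ∫ x in cell, |(φ' x).det| * g (φ x) :=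
        setIntegral_congr_set volume_strip_inter_ae_cell

/-! ### Cross products and partial derivatives on the slab -/

/-- The planar cross product. -/
def cross (v w : ℝ × ℝ) : ℝ := v.1 * w.2 - v.2 * w.1

/-- The moving domain as a map on space-time. -/
def flow (Φ : ℝ → ℝ × ℝ → ℝ × ℝ) (q : ℝ × (ℝ × ℝ)) : ℝ × ℝ := Φ q.1 q.2

theorem hasDerivAt_fst {f : ℝ → ℝ × ℝ} {f' : ℝ × ℝ} {x : ℝ} (h : HasDerivAt f f' x) :
    HasDerivAt (fun s => (f s).1) f'.1 x :=
  (hasFDerivAt_fst (𝕜 := ℝ) (p := f x)).comp_hasDerivAt x h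

theorem hasDerivAt_snd {f : ℝ → ℝ × ℝ} {f' : ℝ × ℝ} {x : ℝ} (h : HasDerivAt f f' x) :
    HasDerivAt (fun s => (f s).2) f'.2 x :=
  (hasFDerivAt_snd (𝕜 := ℝ) (p := f x)).comp_hasDerivAt x h

/-- Cramer's rule. -/
theorem cross_smul_add_cross_smul {v w : ℝ × ℝ} (h : cross v w ≠ 0) (z : ℝ × ℝ) :
    (cross z w / cross v w) • v + (cross v z / cross v w) • w = z := by
  ext
  · simp only [Prod.fst_add, Prod.smul_fst, smul_eq_mul]
    rw [div_mul_eq_mul_div, div_mul_eq_mul_div, ← add_div, div_eq_iff h]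
    unfold cross; ring
  · simp only [Prod.snd_add, Prod.smul_snd, smul_eq_mul]
    rw [div_mul_eq_mul_div, div_mul_eq_mul_div, ← add_div, div_eq_iff h]
    unfold cross; ring

section

variable {F : Type*} [NormedAddCommGroup F] [NormedSpace ℝ F]

/-- Derivative in the horizontal direction on the slab. -/
def dx (T : EReal) (f : ℝ × (ℝ × ℝ) → F) : ℝ × (ℝ × ℝ) → F := pd (slab T) f (0, (1, 0))

/-- Derivative in the vertical direction on the slab. -/
def dy (T : EReal) (f : ℝ × (ℝ × ℝ) → F) : ℝ × (ℝ × ℝ) → F := pd (slab T) f (0, (0, 1))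

/-- Derivative in time on the slab. -/
def dt (T : EReal) (f : ℝ × (ℝ × ℝ) → F) : ℝ × (ℝ × ℝ) → F := pd (slab T) f (1, 0)

theorem hasDerivAt_dt {T : EReal} {f : ℝ × (ℝ × ℝ) → F} (hf : ContDiffOn ℝ 1 f (slab T))
    {t : ℝ} (ht : timeInterval T ∈ 𝓝 t) {x : ℝ × ℝ} (hx : x ∈ closedStrip) :
    HasDerivAt (fun s => f (s, x)) (dt T f (t, x)) t :=
  hasDerivAt_slice (hf.differentiableOn (by norm_num) _ ⟨mem_of_mem_nhds ht, hx⟩) ht hx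

theorem hasFDerivWithinAt_space {T : EReal} {f : ℝ × (ℝ × ℝ) → F} (hf : ContDiffOn ℝ 1 f (slab T))
    {t : ℝ} (ht : t ∈ timeInterval T) {x : ℝ × ℝ} (hx : x ∈ closedStrip) :
    HasFDerivWithinAt (fun y => f (t, y))
      ((fderivWithin ℝ f (slab T) (t, x)).comp (ContinuousLinearMap.inr ℝ ℝ (ℝ × ℝ)))
      closedStrip x :=
  hasFDerivWithinAt_slice (hf.differentiableOn (by norm_num) _ ⟨ht, hx⟩).hasFDerivWithinAt ht

theorem hasDerivAt_dx {T : EReal} {f : ℝ × (ℝ × ℝ) → F} (hf : ContDiffOn ℝ 1 f (slab T))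
    {t : ℝ} (ht : t ∈ timeInterval T) {b : ℝ} (hb : b ∈ Icc (0 : ℝ) 2) (a : ℝ) :
    HasDerivAt (fun a => f (t, (a, b))) (dx T f (t, (a, b))) a := by
  have h := (hasFDerivWithinAt_space hf ht (x := (a, b)) hb).comp_hasDerivAt a
    (f := fun a : ℝ => (a, b)) ((hasDerivAt_id a).prodMk (hasDerivAt_const a b))
    (Eventually.of_forall fun _ => hb)
  simpa [dx, pd, Function.comp_def] using h

end

/-! ### Geometry of the moving domain -/

section MovingDomain

variable {T : EReal} {Φ : ℝ → ℝ × ℝ → ℝ × ℝ}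

/-- The Jacobian determinant of `Φ_t`. -/
def jac (T : EReal) (Φ : ℝ → ℝ × ℝ → ℝ × ℝ) (q : ℝ × (ℝ × ℝ)) : ℝ :=
  cross (dx T (flow Φ) q) (dy T (flow Φ) q)

theorem det_prod (f : ℝ × ℝ →L[ℝ] ℝ × ℝ) : f.det = cross (f (1, 0)) (f (0, 1)) := by
  rw [ContinuousLinearMap.det, ← LinearMap.det_toMatrix (Module.Basis.finTwoProd ℝ),
    Matrix.det_fin_two]
  simp [LinearMap.toMatrix_apply, cross]
  ring

namespace IsMovingDomain

theorem flow_contDiffOn (h : IsMovingDomain T Φ) : ContDiffOn ℝ 2 (flow Φ) (slab T) := h.contDiffOn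

theorem flow_contDiffOn_one (h : IsMovingDomain T Φ) : ContDiffOn ℝ 1 (flow Φ) (slab T) :=
  h.flow_contDiffOn.of_le (by norm_num)

theorem dx_contDiffOn (h : IsMovingDomain T Φ) (hT : 0 < T) :
    ContDiffOn ℝ 1 (dx T (flow Φ)) (slab T) :=
  contDiffOn_pd (uniqueDiffOn_slab hT) h.flow_contDiffOn (by norm_num) _

theorem dy_contDiffOn (h : IsMovingDomain T Φ) (hT : 0 < T) :
    ContDiffOn ℝ 1 (dy T (flow Φ)) (slab T) :=
  contDiffOn_pd (uniqueDiffOn_slab hT) h.flow_contDiffOn (by norm_num) _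

theorem dt_contDiffOn (h : IsMovingDomain T Φ) (hT : 0 < T) :
    ContDiffOn ℝ 1 (dt T (flow Φ)) (slab T) :=
  contDiffOn_pd (uniqueDiffOn_slab hT) h.flow_contDiffOn (by norm_num) _

theorem flow_add_period (h : IsMovingDomain T Φ) :
    ∀ q ∈ slab T, flow Φ (q + (0, period)) = flow Φ q + period := by
  rintro ⟨t, x⟩ ⟨ht, hx⟩
  simpa [flow] using h.periodic t ht x hx

theorem pd_add_period (h : IsMovingDomain T Φ) (hT : 0 < T) {q : ℝ × (ℝ × ℝ)} (hq : q ∈ slab T)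
    (v : ℝ × (ℝ × ℝ)) :
    pd (slab T) (flow Φ) v (q + (0, period)) = pd (slab T) (flow Φ) v q :=
  pd_translate (uniqueDiffOn_slab hT) slab_add_period h.flow_add_period
    (h.flow_contDiffOn.differentiableOn (by norm_num)) hq v

theorem jac_contDiffOn (h : IsMovingDomain T Φ) (hT : 0 < T) :
    ContDiffOn ℝ 1 (jac T Φ) (slab T) := by
  have hA := h.dx_contDiffOn hT
  have hB := h.dy_contDiffOn hT
  exact (hA.fst.mul hB.snd).sub (hA.snd.mul hB.fst)

theorem det_fderivWithin (h : IsMovingDomain T Φ) {t : ℝ} (ht : t ∈ timeInterval T)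
    {x : ℝ × ℝ} (hx : x ∈ closedStrip) :
    (fderivWithin ℝ (Φ t) closedStrip x).det = jac T Φ (t, x) := by
  have := (hasFDerivWithinAt_space h.flow_contDiffOn_one ht hx).fderivWithin
    (uniqueDiffOn_closedStrip x hx)
  change fderivWithin ℝ (Φ t) closedStrip x = _ at this
  rw [this, det_prod]
  rfl

theorem jac_ne_zero (h : IsMovingDomain T Φ) {q : ℝ × (ℝ × ℝ)} (hq : q ∈ slab T) :
    jac T Φ q ≠ 0 := by
  have := h.det_ne_zero q.1 hq.1 q.2 hq.2
  rwa [h.det_fderivWithin hq.1 hq.2] at this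

theorem fderivWithin_zero (h : IsMovingDomain T Φ) {x : ℝ × ℝ} (hx : x ∈ closedStrip) :
    fderivWithin ℝ (Φ 0) closedStrip x = ContinuousLinearMap.id ℝ (ℝ × ℝ) :=
  ((hasFDerivWithinAt_id x closedStrip).congr (fun y hy => h.initial y hy)
    (h.initial x hx)).fderivWithin (uniqueDiffOn_closedStrip x hx)

theorem dx_flow_zero (h : IsMovingDomain T Φ) (hT : 0 < T) {x : ℝ × ℝ} (hx : x ∈ closedStrip) :
    dx T (flow Φ) (0, x) = (1, 0) := by
  have h1 := (hasFDerivWithinAt_space h.flow_contDiffOn_one (zero_mem_timeInterval hT)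
    hx).fderivWithin (uniqueDiffOn_closedStrip x hx)
  change fderivWithin ℝ (Φ 0) closedStrip x = _ at h1
  rw [h.fderivWithin_zero hx] at h1
  exact (DFunLike.congr_fun h1 (1, 0)).symm

/-- The Jacobian is continuous and nonvanishing on the connected slab and equals `1` at time `0`.
Positivity removes the absolute value from the change of variables, so that the energy density is
differentiable in time. -/
theorem jac_pos (h : IsMovingDomain T Φ) (hT : 0 < T) {q : ℝ × (ℝ × ℝ)} (hq : q ∈ slab T) :
    0 < jac T Φ q := by
  have h0 : ((0 : ℝ), ((0 : ℝ), (0 : ℝ))) ∈ slab T :=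
    ⟨zero_mem_timeInterval hT, by simp [closedStrip]⟩
  have hj0 : jac T Φ (0, (0, 0)) = 1 := by
    rw [← h.det_fderivWithin h0.1 h0.2, h.fderivWithin_zero h0.2, det_prod]
    simp [cross]
  by_contra! hle
  obtain ⟨r, hr, hr0⟩ := (convex_slab T).isPreconnected.intermediate_value hq h0
    (h.jac_contDiffOn hT).continuousOn ⟨hle, hj0 ▸ zero_le_one⟩
  exact h.jac_ne_zero hr hr0

theorem hasFDerivAt_space (h : IsMovingDomain T Φ) {t : ℝ} (ht : t ∈ timeInterval T)
    {x : ℝ × ℝ} (hx : x ∈ strip) :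
    HasFDerivAt (Φ t) ((fderivWithin ℝ (flow Φ) (slab T) (t, x)).comp
      (ContinuousLinearMap.inr ℝ ℝ (ℝ × ℝ))) x :=
  (hasFDerivWithinAt_space h.flow_contDiffOn_one ht (strip_subset hx)).hasFDerivAt
    (closedStrip_mem_nhds hx)

theorem map_mem_closure (h : IsMovingDomain T Φ) {t : ℝ} (ht : t ∈ timeInterval T)
    {x : ℝ × ℝ} (hx : x ∈ closedStrip) : Φ t x ∈ closure (fluidDomain Φ t) := by
  have hc : ContinuousOn (Φ t) closedStrip := fun y hy =>
    (hasFDerivWithinAt_space h.flow_contDiffOn_one ht hy).continuousWithinAt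
  exact ((hc x hx).mono strip_subset).mem_closure_image (closedStrip_subset_closure hx)

theorem dx_flow_snd_bottom (h : IsMovingDomain T Φ) {t : ℝ}
    (ht : t ∈ timeInterval T) (a : ℝ) : (dx T (flow Φ) (t, (a, 0))).2 = 0 := by
  have h1 := hasDerivAt_snd
    (hasDerivAt_dx h.flow_contDiffOn_one ht (b := 0) ⟨le_rfl, by norm_num⟩ a)
  have h2 : (fun a : ℝ => (flow Φ (t, (a, 0))).2) = fun _ => 0 := funext fun a => h.bottom t ht a
  rw [h2] at h1
  exact h1.unique (hasDerivAt_const a 0)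

theorem dt_flow_snd_bottom (h : IsMovingDomain T Φ) {t : ℝ}
    (ht : timeInterval T ∈ 𝓝 t) (a : ℝ) : (dt T (flow Φ) (t, (a, 0))).2 = 0 := by
  have h1 := hasDerivAt_snd (hasDerivAt_dt h.flow_contDiffOn_one ht (x := (a, 0))
    ⟨le_rfl, by norm_num⟩)
  have h2 : (fun s : ℝ => (flow Φ (s, (a, 0))).2) =ᶠ[𝓝 t] fun _ => 0 := by
    filter_upwards [ht] with s hs using h.bottom s hs a
  exact (h1.congr_of_eventuallyEq h2.symm).unique (hasDerivAt_const t 0)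

/-- The image of a space-time neighbourhood under `(t, x) ↦ (t, Φ_t x)` is a neighbourhood. -/
theorem spaceTime_mem_nhds (h : IsMovingDomain T Φ) {t : ℝ} (ht : timeInterval T ∈ 𝓝 t)
    {x : ℝ × ℝ} (hx : x ∈ strip) : spaceTime T Φ ∈ 𝓝 (t, Φ t x) := by
  have hq : slab T ∈ 𝓝 (t, x) := slab_mem_nhds ht hx
  have hcd : ContDiffAt ℝ 1 (flow Φ) (t, x) := h.flow_contDiffOn_one.contDiffAt hq
  have hs := hcd.hasStrictFDerivAt (by norm_num)
  have hs' : HasStrictFDerivAt (fun q : ℝ × (ℝ × ℝ) => (q.1, flow Φ q))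
      ((ContinuousLinearMap.fst ℝ ℝ (ℝ × ℝ)).prod (fderiv ℝ (flow Φ) (t, x))) (t, x) :=
    hasStrictFDerivAt_fst.prodMk hs
  have hsurj : ((ContinuousLinearMap.fst ℝ ℝ (ℝ × ℝ)).prod (fderiv ℝ (flow Φ) (t, x))).range = ⊤ := by
    have hj : cross (fderiv ℝ (flow Φ) (t, x) (0, (1, 0))) (fderiv ℝ (flow Φ) (t, x) (0, (0, 1)))
        ≠ 0 := by
      have := h.jac_ne_zero (mem_of_mem_nhds hq)
      simpa only [jac, dx, dy, pd, fderivWithin_of_mem_nhds hq] using this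
    rw [LinearMap.range_eq_top]
    rintro ⟨s, w⟩
    set L := fderiv ℝ (flow Φ) (t, x)
    set A := L (0, (1, 0))
    set B := L (0, (0, 1))
    set w' := w - s • L (1, 0) with hw'
    -- The time component must be `s`; what remains of `w` after removing the contribution of `∂ₜΦ`
    -- is expanded in the basis `A`, `B`.
    refine ⟨(s, (cross w' B / cross A B, cross A w' / cross A B)), ?_⟩
    have hdec : ((s, (cross w' B / cross A B, cross A w' / cross A B)) : ℝ × (ℝ × ℝ)) =
        s • (1, 0) + (cross w' B / cross A B) • (0, (1, 0)) +
          (cross A w' / cross A B) • (0, (0, 1)) := by simp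
    have hL : L (s, (cross w' B / cross A B, cross A w' / cross A B)) = w := by
      rw [hdec, map_add, map_add, map_smul, map_smul, map_smul]
      rw [add_assoc]
      change s • L (1, 0) + ((cross w' B / cross A B) • A + (cross A w' / cross A B) • B) = w
      rw [cross_smul_add_cross_smul hj, hw']; abel
    simpa using hL
  have hmap := hs'.map_nhds_eq_of_surj hsurj
  change _ ∈ 𝓝 ((t, flow Φ (t, x)) : ℝ × (ℝ × ℝ))
  rw [← hmap, mem_map]
  filter_upwards [hq] with q hq
  exact ⟨hq.1, h.map_mem_closure hq.1 hq.2⟩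

end IsMovingDomain

end MovingDomain

/-! ### Product rules and the divergence theorem for `C¹` fields -/

theorem hasDerivAt_cross {f g : ℝ → ℝ × ℝ} {f' g' : ℝ × ℝ} {x : ℝ} (hf : HasDerivAt f f' x)
    (hg : HasDerivAt g g' x) :
    HasDerivAt (fun s => cross (f s) (g s)) (cross f' (g x) + cross (f x) g') x := by
  refine (((hasDerivAt_fst hf).mul (hasDerivAt_snd hg)).sub
    ((hasDerivAt_snd hf).mul (hasDerivAt_fst hg))).congr_deriv ?_
  simp only [cross]; ring

theorem hasDerivAt_dot {f g : ℝ → ℝ × ℝ} {f' g' : ℝ × ℝ} {x : ℝ} (hf : HasDerivAt f f' x)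
    (hg : HasDerivAt g g' x) :
    HasDerivAt (fun s => dot (f s) (g s)) (dot f' (g x) + dot (f x) g') x := by
  refine (((hasDerivAt_fst hf).mul (hasDerivAt_fst hg)).add
    ((hasDerivAt_snd hf).mul (hasDerivAt_snd hg))).congr_deriv ?_
  simp only [dot]; ring

section

variable {E : Type*} [NormedAddCommGroup E] [NormedSpace ℝ E]

theorem contDiffOn_cross {n : ℕ∞ω} {f g : E → ℝ × ℝ} {s : Set E} (hf : ContDiffOn ℝ n f s)
    (hg : ContDiffOn ℝ n g s) : ContDiffOn ℝ n (fun x => cross (f x) (g x)) s :=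
  (hf.fst.mul hg.snd).sub (hf.snd.mul hg.fst)

theorem contDiffOn_dot {n : ℕ∞ω} {f g : E → ℝ × ℝ} {s : Set E} (hf : ContDiffOn ℝ n f s)
    (hg : ContDiffOn ℝ n g s) : ContDiffOn ℝ n (fun x => dot (f x) (g x)) s :=
  (hf.fst.mul hg.fst).add (hf.snd.mul hg.snd)

end

section

variable {X : Type*} [TopologicalSpace X]

theorem continuousOn_cross {f g : X → ℝ × ℝ} {s : Set X} (hf : ContinuousOn f s)
    (hg : ContinuousOn g s) : ContinuousOn (fun x => cross (f x) (g x)) s :=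
  (hf.fst.mul hg.snd).sub (hf.snd.mul hg.fst)

theorem continuousOn_dot {f g : X → ℝ × ℝ} {s : Set X} (hf : ContinuousOn f s)
    (hg : ContinuousOn g s) : ContinuousOn (fun x => dot (f x) (g x)) s :=
  (hf.fst.mul hg.fst).add (hf.snd.mul hg.snd)

end

theorem clm_apply_eq (M : ℝ × ℝ →L[ℝ] ℝ × ℝ) (v : ℝ × ℝ) :
    M v = v.1 • M (1, 0) + v.2 • M (0, 1) := by
  rw [← map_smul, ← map_smul, ← map_add]; simp

/-- The divergence theorem on a period cell for `C¹` periodic fields. -/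
theorem integral_divergence_cell {g h e : ℝ × ℝ → ℝ} (hg : ContDiffOn ℝ 1 g closedStrip)
    (hh : ContDiffOn ℝ 1 h closedStrip) (hper : ∀ x ∈ closedStrip, g (x + period) = g x)
    (he : ∀ x ∈ strip, ∃ d₁ d₂, HasDerivAt (fun a => g (a, x.2)) d₁ x.1 ∧
      HasDerivAt (fun b => h (x.1, b)) d₂ x.2 ∧ d₁ + d₂ = e x) :
    ∫ x in cell, e x = (∫ a in (-1 : ℝ)..1, h (a, 2)) - ∫ a in (-1 : ℝ)..1, h (a, 0) := by
  have hcont : ∀ {f : ℝ × ℝ → ℝ} (v : ℝ × ℝ), ContDiffOn ℝ 1 f closedStrip →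
      ContinuousOn (fun x => fderivWithin ℝ f closedStrip x v) cell := fun v hf =>
    (continuousOn_pd uniqueDiffOn_closedStrip hf v).mono cell_subset
  rw [← integral_divergence_periodic
    (fun x hx => (hg.differentiableOn (by norm_num) x hx).hasFDerivWithinAt)
    (fun x hx => (hh.differentiableOn (by norm_num) x hx).hasFDerivWithinAt) hper
    (((hcont (1, 0) hg).add (hcont (0, 1) hh)).integrableOn_compact isCompact_cell),
    -- Discarding a null set moves the integral to the open strip, the only place where `he` gives
    -- information.
    ← setIntegral_congr_set volume_strip_inter_ae_cell,
    ← setIntegral_congr_set volume_strip_inter_ae_cell]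
  refine setIntegral_congr_fun (isOpen_strip.measurableSet.inter measurableSet_halfOpenCell)
    fun x hx => ?_
  obtain ⟨d₁, d₂, h₁, h₂, hsum⟩ := he x hx.1
  have hF : ∀ {f : ℝ × ℝ → ℝ}, ContDiffOn ℝ 1 f closedStrip →
      HasFDerivAt f (fderivWithin ℝ f closedStrip x) x := fun hf =>
    (hf.differentiableOn (by norm_num) x (strip_subset hx.1)).hasFDerivWithinAt.hasFDerivAt
      (closedStrip_mem_nhds hx.1)
  have e₁ : fderivWithin ℝ g closedStrip x (1, 0) = d₁ :=
    ((hF hg).comp_hasDerivAt x.1 (f := fun a : ℝ => (a, x.2))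
      ((hasDerivAt_id x.1).prodMk (hasDerivAt_const x.1 x.2))).unique h₁
  have e₂ : fderivWithin ℝ h closedStrip x (0, 1) = d₂ :=
    ((hF hh).comp_hasDerivAt x.2 (f := fun b : ℝ => (x.1, b))
      ((hasDerivAt_const x.2 x.1).prodMk (hasDerivAt_id x.2))).unique h₂
  rw [e₁, e₂, hsum]

theorem hasDerivAt_dy {F : Type*} [NormedAddCommGroup F] [NormedSpace ℝ F] {T : EReal}
    {f : ℝ × (ℝ × ℝ) → F} (hf : ContDiffOn ℝ 1 f (slab T)) {t : ℝ} (ht : t ∈ timeInterval T)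
    {x : ℝ × ℝ} (hx : x ∈ strip) :
    HasDerivAt (fun b => f (t, (x.1, b))) (dy T f (t, x)) x.2 := by
  have h := ((hasFDerivWithinAt_space hf ht (strip_subset hx)).hasFDerivAt
    (closedStrip_mem_nhds hx)).comp_hasDerivAt x.2 (f := fun b : ℝ => (x.1, b))
    ((hasDerivAt_const x.2 x.1).prodMk (hasDerivAt_id x.2))
  simpa [dy, pd, Function.comp_def] using h

theorem contDiffOn_space {F : Type*} [NormedAddCommGroup F] [NormedSpace ℝ F] {T : EReal}
    {f : ℝ × (ℝ × ℝ) → F} {n : ℕ∞ω} (hf : ContDiffOn ℝ n f (slab T)) {t : ℝ}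
    (ht : t ∈ timeInterval T) : ContDiffOn ℝ n (fun x => f (t, x)) closedStrip :=
  hf.comp (contDiff_const.prodMk contDiff_id).contDiffOn fun _ hx => ⟨ht, hx⟩

/-! ### The Euler equations in reference coordinates -/

/-- The velocity in the reference coordinates. -/
def vel (Φ : ℝ → ℝ × ℝ → ℝ × ℝ) (u : ℝ → ℝ × ℝ → ℝ × ℝ) (q : ℝ × (ℝ × ℝ)) : ℝ × ℝ :=
  u q.1 (Φ q.1 q.2)

namespace IsSolution

variable {σ : ℝ} {T : EReal} {Φ : ℝ → ℝ × ℝ → ℝ × ℝ} {u : ℝ → ℝ × ℝ → ℝ × ℝ} {p : ℝ → ℝ × ℝ → ℝ}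

theorem vel_contDiffOn (h : IsSolution σ T Φ u p) : ContDiffOn ℝ 1 (vel Φ u) (slab T) :=
  h.velocity_contDiffOn.comp (contDiffOn_fst.prodMk h.movingDomain.flow_contDiffOn_one)
    fun _ hq => ⟨hq.1, h.movingDomain.map_mem_closure hq.1 hq.2⟩

theorem pressure_comp_contDiffOn (h : IsSolution σ T Φ u p) {t : ℝ} (ht : t ∈ timeInterval T) :
    ContDiffOn ℝ 1 (fun x => p t (Φ t x)) closedStrip :=
  (h.pressure_contDiffOn t ht).comp (contDiffOn_space h.movingDomain.flow_contDiffOn_one ht)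
    fun _ hx => h.movingDomain.map_mem_closure ht hx

theorem vel_add_period (h : IsSolution σ T Φ u p) {t : ℝ} (ht : t ∈ timeInterval T) {x : ℝ × ℝ}
    (hx : x ∈ closedStrip) : vel Φ u (t, x + period) = vel Φ u (t, x) := by
  simp only [vel, h.movingDomain.periodic t ht x hx]
  exact h.velocity_periodic t ht _ (h.movingDomain.map_mem_closure ht hx)

/-- The chain rule and the equations of motion in the interior, in reference coordinates. -/
theorem exists_interior (h : IsSolution σ T Φ u p) {t : ℝ} (ht : timeInterval T ∈ 𝓝 t)
    {x : ℝ × ℝ} (hx : x ∈ strip) :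
    ∃ (M : ℝ × ℝ →L[ℝ] ℝ × ℝ) (G : ℝ × ℝ),
      dt T (vel Φ u) (t, x) = M (dt T (flow Φ) (t, x)) - M (vel Φ u (t, x)) - G ∧
      dx T (vel Φ u) (t, x) = M (dx T (flow Φ) (t, x)) ∧
      dy T (vel Φ u) (t, x) = M (dy T (flow Φ) (t, x)) ∧
      HasDerivAt (fun a => p t (Φ t (a, x.2))) (dot G (dx T (flow Φ) (t, x))) x.1 ∧
      HasDerivAt (fun b => p t (Φ t (x.1, b))) (dot G (dy T (flow Φ) (t, x))) x.2 ∧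
      (M (1, 0)).1 + (M (0, 1)).2 = 0 := by
  have hm := h.movingDomain
  have htI := mem_of_mem_nhds ht
  have hxc := strip_subset hx
  have hnhds := hm.spaceTime_mem_nhds ht hx
  have hD : Φ t x ∈ fluidDomain Φ t := ⟨x, hx, rfl⟩
  have hL : HasFDerivAt (fun q : ℝ × (ℝ × ℝ) => u q.1 q.2)
      (fderiv ℝ (fun q : ℝ × (ℝ × ℝ) => u q.1 q.2) (t, Φ t x)) (t, Φ t x) :=
    ((h.velocity_contDiffOn.contDiffAt hnhds).differentiableAt (by norm_num)).hasFDerivAt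
  set L := fderiv ℝ (fun q : ℝ × (ℝ × ℝ) => u q.1 q.2) (t, Φ t x) with hLdef
  have hut : deriv (fun s => u s (Φ t x)) t = L (1, 0) := by
    have := (hL.comp_hasDerivAt t (f := fun s : ℝ => (s, Φ t x))
      ((hasDerivAt_id t).prodMk (hasDerivAt_const t (Φ t x)))).deriv
    simpa [Function.comp_def] using this
  have hux : fderiv ℝ (u t) (Φ t x) = L.comp (ContinuousLinearMap.inr ℝ ℝ (ℝ × ℝ)) :=
    (hL.comp (f := fun y => (t, y)) (Φ t x) (hasFDerivAt_prodMk_right t (Φ t x))).fderiv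
  have hflow : HasFDerivWithinAt (flow Φ) (fderivWithin ℝ (flow Φ) (slab T) (t, x)) (slab T)
      (t, x) :=
    (hm.flow_contDiffOn_one.differentiableOn (by norm_num) (t, x) ⟨htI, hxc⟩).hasFDerivWithinAt
  have hT : 0 < T := lt_of_le_of_lt (by exact_mod_cast htI.1) htI.2
  have hvel : fderivWithin ℝ (vel Φ u) (slab T) (t, x) =
      L.comp ((ContinuousLinearMap.fst ℝ ℝ (ℝ × ℝ)).prod
        (fderivWithin ℝ (flow Φ) (slab T) (t, x))) := by
    have : HasFDerivWithinAt (vel Φ u) _ (slab T) (t, x) :=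
      HasFDerivAt.comp_hasFDerivWithinAt (f := fun q : ℝ × (ℝ × ℝ) => (q.1, flow Φ q)) (t, x) hL
        (hasFDerivWithinAt_fst.prodMk hflow)
    exact this.fderivWithin (uniqueDiffOn_slab hT _ ⟨htI, hxc⟩)
  have hp : HasFDerivAt (p t) (fderiv ℝ (p t) (Φ t x)) (Φ t x) := by
    -- A time slice of the space-time neighbourhood; it turns the one-sided regularity of `p t` into
    -- genuine differentiability.
    have hn : closure (fluidDomain Φ t) ∈ 𝓝 (Φ t x) := by
      have : (fun y => (t, y)) ⁻¹' spaceTime T Φ ∈ 𝓝 (Φ t x) :=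
        (Continuous.prodMk_right t).continuousAt.preimage_mem_nhds hnhds
      exact mem_of_superset this fun y hy => hy.2
    exact (((h.pressure_contDiffOn t htI).contDiffAt hn).differentiableAt
      (by norm_num)).hasFDerivAt
  have hdotG : ∀ v : ℝ × ℝ, fderiv ℝ (p t) (Φ t x) v = dot (grad (p t) (Φ t x)) v := by
    intro v
    have : v = v.1 • ((1 : ℝ), (0 : ℝ)) + v.2 • ((0 : ℝ), (1 : ℝ)) := by simp
    conv_lhs => rw [this, map_add, map_smul, map_smul]
    simp [dot, grad]; ring
  have hmom := h.momentum t htI (pos_of_timeInterval_mem_nhds ht) _ hD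
  have hdiv := h.incompressible t htI _ hD
  rw [hut, hux] at hmom
  rw [divergence, hux] at hdiv
  -- `M` is the spatial derivative of the velocity and `G` the pressure gradient, both at the point
  -- `Φ t x`.
  refine ⟨L.comp (ContinuousLinearMap.inr ℝ ℝ (ℝ × ℝ)), grad (p t) (Φ t x), ?_, ?_, ?_, ?_, ?_,
    hdiv⟩
  · have e : dt T (vel Φ u) (t, x) = L (1, 0) +
        (L.comp (ContinuousLinearMap.inr ℝ ℝ (ℝ × ℝ))) (dt T (flow Φ) (t, x)) := by
      simp only [dt, pd, hvel, ContinuousLinearMap.comp_apply, ContinuousLinearMap.prod_apply,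
        ContinuousLinearMap.inr_apply, ← map_add, Prod.mk_add_mk]
      simp
    have e2 : L (1, 0) = - (L.comp (ContinuousLinearMap.inr ℝ ℝ (ℝ × ℝ))) (vel Φ u (t, x)) -
        grad (p t) (Φ t x) := by
      rw [eq_sub_iff_add_eq, eq_neg_iff_add_eq_zero]
      refine Eq.trans ?_ hmom
      simp only [vel]; abel
    rw [e, e2]; abel
  · simp only [dx, pd, hvel]; simp
  · simp only [dy, pd, hvel]; simp
  · rw [← hdotG]
    exact hp.comp_hasDerivAt x.1 (hasDerivAt_dx hm.flow_contDiffOn_one htI (b := x.2) hxc x.1)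
  · rw [← hdotG]
    exact hp.comp_hasDerivAt x.2 (hasDerivAt_dy hm.flow_contDiffOn_one htI hx)

end IsSolution

theorem pos_of_mem_timeInterval {T : EReal} {t : ℝ} (ht : t ∈ timeInterval T) : 0 < T :=
  lt_of_le_of_lt (by exact_mod_cast ht.1) ht.2

theorem dx_dy_flow {T : EReal} {Φ : ℝ → ℝ × ℝ → ℝ × ℝ} (h : IsMovingDomain T Φ) (hT : 0 < T)
    {q : ℝ × (ℝ × ℝ)} (hq : q ∈ slab T) :
    dx T (dy T (flow Φ)) q = dy T (dx T (flow Φ)) q :=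
  pd_comm (uniqueDiffOn_slab hT) (slab_subset_closure hT) h.flow_contDiffOn hq _ _

theorem dt_dx_flow {T : EReal} {Φ : ℝ → ℝ × ℝ → ℝ × ℝ} (h : IsMovingDomain T Φ) (hT : 0 < T)
    {q : ℝ × (ℝ × ℝ)} (hq : q ∈ slab T) :
    dt T (dx T (flow Φ)) q = dx T (dt T (flow Φ)) q :=
  pd_comm (uniqueDiffOn_slab hT) (slab_subset_closure hT) h.flow_contDiffOn hq _ _

theorem dt_dy_flow {T : EReal} {Φ : ℝ → ℝ × ℝ → ℝ × ℝ} (h : IsMovingDomain T Φ) (hT : 0 < T)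
    {q : ℝ × (ℝ × ℝ)} (hq : q ∈ slab T) :
    dt T (dy T (flow Φ)) q = dy T (dt T (flow Φ)) q :=
  pd_comm (uniqueDiffOn_slab hT) (slab_subset_closure hT) h.flow_contDiffOn hq _ _

/-! ### Energy and arc length densities -/

/-- The kinetic energy density in reference coordinates. -/
def energyDensity (T : EReal) (Φ u : ℝ → ℝ × ℝ → ℝ × ℝ) (q : ℝ × (ℝ × ℝ)) : ℝ :=
  1 / 2 * dot (vel Φ u q) (vel Φ u q) * jac T Φ q

/-- The time derivative of `energyDensity`. -/
def energyDensityDeriv (T : EReal) (Φ u : ℝ → ℝ × ℝ → ℝ × ℝ) (q : ℝ × (ℝ × ℝ)) : ℝ :=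
  dot (vel Φ u q) (dt T (vel Φ u) q) * jac T Φ q +
    1 / 2 * dot (vel Φ u q) (vel Φ u q) *
      (cross (dx T (dt T (flow Φ)) q) (dy T (flow Φ) q) +
        cross (dx T (flow Φ) q) (dy T (dt T (flow Φ)) q))

/-- The arc length density of the free boundary. -/
def speed (T : EReal) (Φ : ℝ → ℝ × ℝ → ℝ × ℝ) (q : ℝ × (ℝ × ℝ)) : ℝ :=
  √(dot (dx T (flow Φ) q) (dx T (flow Φ) q))

theorem dot_self_pos {v w : ℝ × ℝ} (h : cross v w ≠ 0) : 0 < dot v v := by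
  have hne : v ≠ 0 := by rintro rfl; simp [cross] at h
  rcases lt_or_eq_of_le (show 0 ≤ dot v v from add_nonneg (mul_self_nonneg _) (mul_self_nonneg _))
    with h' | h'
  · exact h'
  · obtain ⟨h1, h2⟩ := mul_self_add_mul_self_eq_zero.1 h'.symm
    exact absurd (Prod.ext h1 h2) hne

theorem IsMovingDomain.speed_pos {T : EReal} {Φ : ℝ → ℝ × ℝ → ℝ × ℝ} (h : IsMovingDomain T Φ)
    {q : ℝ × (ℝ × ℝ)} (hq : q ∈ slab T) : 0 < dot (dx T (flow Φ) q) (dx T (flow Φ) q) :=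
  dot_self_pos (h.jac_ne_zero hq)

theorem mem_closedStrip_top (a : ℝ) : ((a, 2) : ℝ × ℝ) ∈ closedStrip := ⟨by norm_num, le_rfl⟩

theorem IsMovingDomain.deriv_surfaceCurve {T : EReal} {Φ : ℝ → ℝ × ℝ → ℝ × ℝ}
    (h : IsMovingDomain T Φ) {t : ℝ} (ht : t ∈ timeInterval T) :
    deriv (surfaceCurve Φ t) = fun a => dx T (flow Φ) (t, (a, 2)) :=
  funext fun a =>
    (hasDerivAt_dx h.flow_contDiffOn_one ht (b := 2) ⟨by norm_num, le_rfl⟩ a).deriv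

theorem IsMovingDomain.deriv_deriv_surfaceCurve {T : EReal} {Φ : ℝ → ℝ × ℝ → ℝ × ℝ}
    (h : IsMovingDomain T Φ) {t : ℝ} (ht : t ∈ timeInterval T) :
    deriv (deriv (surfaceCurve Φ t)) = fun a => dx T (dx T (flow Φ)) (t, (a, 2)) := by
  rw [h.deriv_surfaceCurve ht]
  exact funext fun a => (hasDerivAt_dx (h.dx_contDiffOn (pos_of_mem_timeInterval ht)) ht (b := 2)
    ⟨by norm_num, le_rfl⟩ a).deriv

/-! ### Boundary conditions, flux and energy rate -/

namespace IsSolution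

variable {σ : ℝ} {T : EReal} {Φ : ℝ → ℝ × ℝ → ℝ × ℝ} {u : ℝ → ℝ × ℝ → ℝ × ℝ} {p : ℝ → ℝ × ℝ → ℝ}

/-- The kinematic condition multiplied by the arc length density: crossing with the tangent `A` is
`|A|` times the normal component. Only normal components agree, since `Φ` need not follow particles.
-/
theorem cross_dt_eq (h : IsSolution σ T Φ u p) {t : ℝ} (ht : timeInterval T ∈ 𝓝 t) (a : ℝ) :
    cross (dx T (flow Φ) (t, (a, 2))) (dt T (flow Φ) (t, (a, 2))) =
      cross (dx T (flow Φ) (t, (a, 2))) (vel Φ u (t, (a, 2))) := by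
  have hm := h.movingDomain
  have htI := mem_of_mem_nhds ht
  have hk := h.kinematic t htI (pos_of_timeInterval_mem_nhds ht) a
  have hs : deriv (fun s => surfaceCurve Φ s a) t = dt T (flow Φ) (t, (a, 2)) :=
    (hasDerivAt_dt hm.flow_contDiffOn_one ht (mem_closedStrip_top a)).deriv
  rw [hs] at hk
  simp only [unitNormal, hm.deriv_surfaceCurve htI] at hk
  have hpos : 0 < √(dot (dx T (flow Φ) (t, (a, 2))) (dx T (flow Φ) (t, (a, 2)))) :=
    Real.sqrt_pos.2 (hm.speed_pos ⟨htI, mem_closedStrip_top a⟩)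
  set r := √(dot (dx T (flow Φ) (t, (a, 2))) (dx T (flow Φ) (t, (a, 2))))
  have key : ∀ v : ℝ × ℝ, cross (dx T (flow Φ) (t, (a, 2))) v =
      r * dot v (-(dx T (flow Φ) (t, (a, 2))).2 / r, (dx T (flow Φ) (t, (a, 2))).1 / r) := by
    intro v
    simp only [dot, cross]
    field_simp
    ring
  rw [key, key, hk]
  rfl

theorem vel_snd_bottom (h : IsSolution σ T Φ u p) {t : ℝ} (ht : t ∈ timeInterval T) (a : ℝ) :
    (vel Φ u (t, (a, 0))).2 = 0 := by
  have h1 := h.noFlow t ht (Φ t (a, 0)).1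
  have h2 : Φ t (a, 0) = ((Φ t (a, 0)).1, 0) := Prod.ext rfl (h.movingDomain.bottom t ht a)
  rw [← h2] at h1
  simpa [dot, vel] using h1

/-- There is no net flux of fluid through the free boundary. -/
theorem integral_cross_vel (h : IsSolution σ T Φ u p) {t : ℝ} (ht : timeInterval T ∈ 𝓝 t) :
    ∫ a in (-1 : ℝ)..1, cross (dx T (flow Φ) (t, (a, 2))) (vel Φ u (t, (a, 2))) = 0 := by
  have hm := h.movingDomain
  have htI := mem_of_mem_nhds ht
  have hT := pos_of_mem_timeInterval htI
  have hA := contDiffOn_space (hm.dx_contDiffOn hT) htI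
  have hB := contDiffOn_space (hm.dy_contDiffOn hT) htI
  have hU := contDiffOn_space h.vel_contDiffOn htI
  have hper : ∀ x ∈ closedStrip, cross (vel Φ u (t, x + period)) (dy T (flow Φ) (t, x + period)) =
      cross (vel Φ u (t, x)) (dy T (flow Φ) (t, x)) := by
    intro x hx
    have e := hm.pd_add_period hT (q := (t, x)) ⟨htI, hx⟩ (0, (0, 1))
    simp only [Prod.mk_add_mk, add_zero] at e
    rw [h.vel_add_period htI hx]
    simp only [dy, e]
  -- The Piola transform of the velocity is divergence free: the terms in `∂₁B = ∂₂A` cancel, and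
  -- `cross (M A) B + cross A (M B)` is the trace of `M` times `cross A B`.
  have key := integral_divergence_cell (e := fun _ => 0) (contDiffOn_cross hU hB)
    (contDiffOn_cross hA hU) hper (fun x hx => by
      obtain ⟨M, -, -, h1, h2, -, -, hdiv⟩ := h.exists_interior ht hx
      have hxc := strip_subset hx
      refine ⟨_, _, hasDerivAt_cross (hasDerivAt_dx h.vel_contDiffOn htI (b := x.2) hxc x.1)
        (hasDerivAt_dx (hm.dy_contDiffOn hT) htI (b := x.2) hxc x.1),
        hasDerivAt_cross (hasDerivAt_dy (hm.dx_contDiffOn hT) htI hx)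
          (hasDerivAt_dy h.vel_contDiffOn htI hx), ?_⟩
      have e := dx_dy_flow hm hT (q := (t, x)) ⟨htI, hxc⟩
      simp only [Prod.mk.eta, h1, h2, e]
      rw [clm_apply_eq M (dx T (flow Φ) (t, x)), clm_apply_eq M (dy T (flow Φ) (t, x))]
      simp only [cross, Prod.fst_add, Prod.snd_add, Prod.smul_fst, Prod.smul_snd, smul_eq_mul]
      linear_combination ((dx T (flow Φ) (t, x)).1 * (dy T (flow Φ) (t, x)).2 -
        (dx T (flow Φ) (t, x)).2 * (dy T (flow Φ) (t, x)).1) * hdiv)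
  have hb : ∀ a : ℝ, cross (dx T (flow Φ) (t, (a, 0))) (vel Φ u (t, (a, 0))) = 0 := fun a => by
    simp [cross, hm.dx_flow_snd_bottom htI, h.vel_snd_bottom htI]
  simp only [hb, integral_zero, intervalIntegral.integral_zero, sub_zero] at key
  exact key.symm

theorem hasDerivAt_energyDensity (h : IsSolution σ T Φ u p) {t : ℝ} (ht : timeInterval T ∈ 𝓝 t)
    {x : ℝ × ℝ} (hx : x ∈ closedStrip) :
    HasDerivAt (fun s => energyDensity T Φ u (s, x)) (energyDensityDeriv T Φ u (t, x)) t := by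
  have hm := h.movingDomain
  have htI := mem_of_mem_nhds ht
  have hT := pos_of_mem_timeInterval htI
  have hq : (t, x) ∈ slab T := ⟨htI, hx⟩
  have hU := hasDerivAt_dt h.vel_contDiffOn ht hx
  have hA := hasDerivAt_dt (hm.dx_contDiffOn hT) ht hx
  have hB := hasDerivAt_dt (hm.dy_contDiffOn hT) ht hx
  refine (((hasDerivAt_dot hU hU).const_mul (1 / 2)).mul (hasDerivAt_cross hA hB)).congr_deriv ?_
  rw [dt_dx_flow hm hT hq, dt_dy_flow hm hT hq]
  simp only [energyDensityDeriv, jac, dot, cross]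
  ring

/-- The energy rate is minus the divergence of a Piola transform. Its flux vanishes at the bottom,
where `A`, `U` and `W` are all horizontal. On top the transport term drops out because `U - W` is
tangential, leaving the pressure times the normal velocity. -/
theorem integral_energyDensityDeriv (h : IsSolution σ T Φ u p) {t : ℝ}
    (ht : timeInterval T ∈ 𝓝 t) :
    ∫ x in cell, energyDensityDeriv T Φ u (t, x) =
      -∫ a in (-1 : ℝ)..1, σ * curvature (surfaceCurve Φ t) a *
        cross (dx T (flow Φ) (t, (a, 2))) (dt T (flow Φ) (t, (a, 2))) := by
  have hm := h.movingDomain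
  have htI := mem_of_mem_nhds ht
  have hT := pos_of_mem_timeInterval htI
  have hA := contDiffOn_space (hm.dx_contDiffOn hT) htI
  have hB := contDiffOn_space (hm.dy_contDiffOn hT) htI
  have hW := contDiffOn_space (hm.dt_contDiffOn hT) htI
  have hU := contDiffOn_space h.vel_contDiffOn htI
  have hP := h.pressure_comp_contDiffOn htI
  -- The energy flux: pressure work plus kinetic energy carried by the velocity relative to the
  -- moving coordinates.
  have hF : ContDiffOn ℝ 1 (fun x => p t (Φ t x) • vel Φ u (t, x) +
      (1 / 2 * dot (vel Φ u (t, x)) (vel Φ u (t, x))) • (vel Φ u (t, x) - dt T (flow Φ) (t, x)))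
      closedStrip :=
    (hP.smul hU).add ((contDiffOn_const.mul (contDiffOn_dot hU hU)).smul (hU.sub hW))
  have hper : ∀ x ∈ closedStrip,
      cross (p t (Φ t (x + period)) • vel Φ u (t, x + period) +
        (1 / 2 * dot (vel Φ u (t, x + period)) (vel Φ u (t, x + period))) •
          (vel Φ u (t, x + period) - dt T (flow Φ) (t, x + period)))
        (dy T (flow Φ) (t, x + period)) =
      cross (p t (Φ t x) • vel Φ u (t, x) + (1 / 2 * dot (vel Φ u (t, x)) (vel Φ u (t, x))) •
        (vel Φ u (t, x) - dt T (flow Φ) (t, x))) (dy T (flow Φ) (t, x)) := by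
    intro x hx
    have e := fun v => hm.pd_add_period hT (q := (t, x)) ⟨htI, hx⟩ v
    simp only [Prod.mk_add_mk, add_zero] at e
    rw [h.vel_add_period htI hx, hm.periodic t htI x hx,
      h.pressure_periodic t htI _ (hm.map_mem_closure htI hx)]
    simp only [dy, dt, e]
  have key := integral_divergence_cell (e := fun x => -energyDensityDeriv T Φ u (t, x))
    (contDiffOn_cross hF hB) (contDiffOn_cross hA hF) hper (fun x hx => by
      obtain ⟨M, G, h0, h1, h2, hp1, hp2, hdiv⟩ := h.exists_interior ht hx
      have hxc := strip_subset hx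
      have hq : (t, x) ∈ slab T := ⟨htI, hxc⟩
      have hU1 := hasDerivAt_dx h.vel_contDiffOn htI (b := x.2) hxc x.1
      have hU2 := hasDerivAt_dy h.vel_contDiffOn htI hx
      have hW1 := hasDerivAt_dx (hm.dt_contDiffOn hT) htI (b := x.2) hxc x.1
      have hW2 := hasDerivAt_dy (hm.dt_contDiffOn hT) htI hx
      refine ⟨_, _, hasDerivAt_cross ((hp1.smul hU1).add
          (((hasDerivAt_dot hU1 hU1).const_mul (1 / 2)).smul (hU1.sub hW1)))
        (hasDerivAt_dx (hm.dy_contDiffOn hT) htI (b := x.2) hxc x.1),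
        hasDerivAt_cross (hasDerivAt_dy (hm.dx_contDiffOn hT) htI hx) ((hp2.smul hU2).add
          (((hasDerivAt_dot hU2 hU2).const_mul (1 / 2)).smul (hU2.sub hW2))), ?_⟩
      have e := dx_dy_flow hm hT hq
      simp only [Prod.mk.eta, h1, h2, e, energyDensityDeriv, h0, jac]
      rw [clm_apply_eq M (dx T (flow Φ) (t, x)), clm_apply_eq M (dy T (flow Φ) (t, x)),
        clm_apply_eq M (dt T (flow Φ) (t, x)), clm_apply_eq M (vel Φ u (t, x))]
      -- Incompressibility; with it the divergence identity becomes polynomial.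
      have hM : (M (0, 1)).2 = -(M (1, 0)).1 := by linarith
      simp only [cross, dot, Prod.fst_add, Prod.snd_add, Prod.smul_fst, Prod.smul_snd, smul_eq_mul,
        Prod.fst_sub, Prod.snd_sub, hM]
      ring)
  have hb : ∀ a : ℝ, cross (dx T (flow Φ) (t, (a, 0)))
      (p t (Φ t (a, 0)) • vel Φ u (t, (a, 0)) +
        (1 / 2 * dot (vel Φ u (t, (a, 0))) (vel Φ u (t, (a, 0)))) •
          (vel Φ u (t, (a, 0)) - dt T (flow Φ) (t, (a, 0)))) = 0 := fun a => by
    simp [cross, hm.dx_flow_snd_bottom htI, h.vel_snd_bottom htI, hm.dt_flow_snd_bottom ht]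
  have htop : ∀ a : ℝ, cross (dx T (flow Φ) (t, (a, 2)))
      (p t (Φ t (a, 2)) • vel Φ u (t, (a, 2)) +
        (1 / 2 * dot (vel Φ u (t, (a, 2))) (vel Φ u (t, (a, 2)))) •
          (vel Φ u (t, (a, 2)) - dt T (flow Φ) (t, (a, 2)))) =
      σ * curvature (surfaceCurve Φ t) a *
        cross (dx T (flow Φ) (t, (a, 2))) (dt T (flow Φ) (t, (a, 2))) := fun a => by
    have e := h.cross_dt_eq ht a
    have hs := h.surfaceTension t htI a
    simp only [surfaceCurve] at hs
    rw [← show p t (Φ t (a, 2)) = σ * curvature (surfaceCurve Φ t) a from hs]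
    simp only [cross, Prod.fst_add, Prod.snd_add, Prod.smul_fst, Prod.smul_snd, smul_eq_mul,
      Prod.fst_sub, Prod.snd_sub] at e ⊢
    linear_combination (-(p t (Φ t (a, 2))) -
      1 / 2 * dot (vel Φ u (t, (a, 2))) (vel Φ u (t, (a, 2)))) * e
  simp only [hb, htop, intervalIntegral.integral_zero, sub_zero, integral_neg] at key
  linarith

end IsSolution

/-! ### First variation of length -/

/-- The time derivative of the arc length density. -/
def speedDeriv (T : EReal) (Φ : ℝ → ℝ × ℝ → ℝ × ℝ) (q : ℝ × (ℝ × ℝ)) : ℝ :=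
  dot (dx T (flow Φ) q) (dx T (dt T (flow Φ)) q) / speed T Φ q

namespace IsMovingDomain

variable {T : EReal} {Φ : ℝ → ℝ × ℝ → ℝ × ℝ}

theorem top_add_period (h : IsMovingDomain T Φ) {t : ℝ} (ht : t ∈ timeInterval T) (a : ℝ)
    (v : ℝ × (ℝ × ℝ)) :
    pd (slab T) (flow Φ) v (t, (a + 2, 2)) = pd (slab T) (flow Φ) v (t, (a, 2)) := by
  have := h.pd_add_period (pos_of_mem_timeInterval ht) (q := (t, (a, 2)))
    ⟨ht, mem_closedStrip_top a⟩ v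
  simpa [period] using this

theorem flow_top_add_period (h : IsMovingDomain T Φ) {t : ℝ} (ht : t ∈ timeInterval T) (a : ℝ) :
    flow Φ (t, (a + 2, 2)) = flow Φ (t, (a, 2)) + (2, 0) := by
  have := h.flow_add_period (t, (a, 2)) ⟨ht, mem_closedStrip_top a⟩
  simpa [period] using this

theorem hasDerivAt_speed (h : IsMovingDomain T Φ) {t : ℝ} (ht : timeInterval T ∈ 𝓝 t)
    {x : ℝ × ℝ} (hx : x ∈ closedStrip) :
    HasDerivAt (fun s => speed T Φ (s, x)) (speedDeriv T Φ (t, x)) t := by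
  have htI := mem_of_mem_nhds ht
  have hT := pos_of_mem_timeInterval htI
  have hA := hasDerivAt_dt (h.dx_contDiffOn hT) ht hx
  refine ((hasDerivAt_dot hA hA).sqrt (h.speed_pos ⟨htI, hx⟩).ne').congr_deriv ?_
  have e : ∀ v w : ℝ × ℝ, dot w v + dot v w = 2 * dot v w := fun v w => by
    simp only [dot]; ring
  rw [dt_dx_flow h hT ⟨htI, hx⟩, speedDeriv, speed, e, mul_div_mul_left _ _ two_ne_zero]

theorem speed_continuousOn (h : IsMovingDomain T Φ) (hT : 0 < T) :
    ContinuousOn (speed T Φ) (slab T) :=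
  (continuousOn_dot (h.dx_contDiffOn hT).continuousOn (h.dx_contDiffOn hT).continuousOn).sqrt

theorem dx_dt_continuousOn (h : IsMovingDomain T Φ) (hT : 0 < T) :
    ContinuousOn (dx T (dt T (flow Φ))) (slab T) :=
  continuousOn_pd (uniqueDiffOn_slab hT) (h.dt_contDiffOn hT) _

theorem speedDeriv_continuousOn (h : IsMovingDomain T Φ) (hT : 0 < T) :
    ContinuousOn (speedDeriv T Φ) (slab T) :=
  (continuousOn_dot (h.dx_contDiffOn hT).continuousOn (h.dx_dt_continuousOn hT)).div
    (h.speed_continuousOn hT) fun _ hq => (Real.sqrt_pos.2 (h.speed_pos hq)).ne'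

theorem continuous_top {F : Type*} [TopologicalSpace F] {f : ℝ × (ℝ × ℝ) → F}
    (hf : ContinuousOn f (slab T)) {t : ℝ} (ht : t ∈ timeInterval T) :
    Continuous fun a : ℝ => f (t, (a, 2)) :=
  hf.comp_continuous (by fun_prop) fun a => ⟨ht, mem_closedStrip_top a⟩

theorem continuousOn_top {F : Type*} [TopologicalSpace F] {f : ℝ × (ℝ × ℝ) → F}
    (hf : ContinuousOn f (slab T)) :
    ContinuousOn (fun r : ℝ × ℝ => f (r.1, (r.2, 2))) (timeInterval T ×ˢ Icc (-1) 1) :=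
  hf.comp (by fun_prop) fun r hr => ⟨hr.1, mem_closedStrip_top r.2⟩

/-- First variation of the length of the free boundary. -/
theorem integral_speedDeriv (h : IsMovingDomain T Φ) {t : ℝ} (ht : t ∈ timeInterval T) :
    ∫ a in (-1 : ℝ)..1, speedDeriv T Φ (t, (a, 2)) =
      ∫ a in (-1 : ℝ)..1, curvature (surfaceCurve Φ t) a *
        cross (dx T (flow Φ) (t, (a, 2))) (dt T (flow Φ) (t, (a, 2))) := by
  have hT := pos_of_mem_timeInterval ht
  have hb : (2 : ℝ) ∈ Icc (0 : ℝ) 2 := ⟨by norm_num, le_rfl⟩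
  have hsp : ∀ a : ℝ, 0 < speed T Φ (t, (a, 2)) := fun a =>
    Real.sqrt_pos.2 (h.speed_pos ⟨ht, mem_closedStrip_top a⟩)
  have hsq : ∀ a : ℝ, speed T Φ (t, (a, 2)) ^ 2 =
      dot (dx T (flow Φ) (t, (a, 2))) (dx T (flow Φ) (t, (a, 2))) := fun a =>
    Real.sq_sqrt (h.speed_pos ⟨ht, mem_closedStrip_top a⟩).le
  have hcurv : ∀ a : ℝ, curvature (surfaceCurve Φ t) a =
      -cross (dx T (flow Φ) (t, (a, 2))) (dx T (dx T (flow Φ)) (t, (a, 2))) /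
        speed T Φ (t, (a, 2)) ^ 3 := fun a => by
    rw [curvature, h.deriv_deriv_surfaceCurve ht, h.deriv_surfaceCurve ht, speed, cross]
    congr 1; ring
  -- The tangential component of `W` is differentiated along the curve. Where the derivative falls
  -- on `W` it gives the rate of the arc length density; where it falls on the unit tangent it gives
  -- minus curvature times normal component. A periodic function has total change zero, so the two
  -- integrals agree.
  have hd : ∀ a : ℝ, HasDerivAt (fun a => dot (dx T (flow Φ) (t, (a, 2)))
      (dt T (flow Φ) (t, (a, 2))) / speed T Φ (t, (a, 2)))
      (speedDeriv T Φ (t, (a, 2)) - curvature (surfaceCurve Φ t) a *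
        cross (dx T (flow Φ) (t, (a, 2))) (dt T (flow Φ) (t, (a, 2)))) a := fun a => by
    have hA := hasDerivAt_dx (h.dx_contDiffOn hT) ht hb a
    have hW := hasDerivAt_dx (h.dt_contDiffOn hT) ht hb a
    have hS := (hasDerivAt_dot hA hA).sqrt (h.speed_pos ⟨ht, mem_closedStrip_top a⟩).ne'
    refine ((hasDerivAt_dot hA hW).div hS (hsp a).ne').congr_deriv ?_
    have hr := hsp a
    have hr2 := hsq a
    rw [hcurv, speedDeriv]
    change (_ * speed T Φ (t, (a, 2)) - _ * (_ / (2 * speed T Φ (t, (a, 2))))) /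
      speed T Φ (t, (a, 2)) ^ 2 = _
    set r := speed T Φ (t, (a, 2))
    simp only [dot, cross] at hr2 ⊢
    field_simp
    rw [hr2]
    ring
  have hA := continuous_top (h.dx_contDiffOn hT).continuousOn ht
  have hW := continuous_top (h.dt_contDiffOn hT).continuousOn ht
  have hAA := continuous_top (continuousOn_pd (uniqueDiffOn_slab hT) (h.dx_contDiffOn hT)
    (0, (1, 0))) ht
  have hSc := continuous_top (h.speed_continuousOn hT) ht
  have hcr : ∀ {f g : ℝ → ℝ × ℝ}, Continuous f → Continuous g →
      Continuous fun a => cross (f a) (g a) := fun hf hg =>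
    (hf.fst.mul hg.snd).sub (hf.snd.mul hg.fst)
  have hcc : Continuous (curvature (surfaceCurve Φ t)) := by
    rw [funext hcurv]
    exact (hcr hA hAA).neg.div (hSc.pow 3) fun a => (pow_pos (hsp a) 3).ne'
  have hi1 := (continuous_top (h.speedDeriv_continuousOn hT) ht).intervalIntegrable
    (μ := volume) (-1) 1
  have hi2 : IntervalIntegrable (fun a => curvature (surfaceCurve Φ t) a *
      cross (dx T (flow Φ) (t, (a, 2))) (dt T (flow Φ) (t, (a, 2)))) volume (-1) 1 :=
    (hcc.mul (hcr hA hW)).intervalIntegrable _ _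
  have ftc := intervalIntegral.integral_eq_sub_of_hasDerivAt (fun a _ => hd a) (hi1.sub hi2)
  rw [intervalIntegral.integral_sub hi1 hi2] at ftc
  have hend : ∀ v, pd (slab T) (flow Φ) v (t, (1, 2)) = pd (slab T) (flow Φ) v (t, (-1, 2)) := by
    intro v
    have := h.top_add_period ht (-1) v
    norm_num at this
    exact this
  simp only [speed, dx, dt, hend, sub_self] at ftc
  simp only [dx, dt]
  exact sub_eq_zero.1 ftc

end IsMovingDomain

/-! ### Conservation of energy and area -/

/-- The length of one period of the free boundary. -/
def surfaceLength (T : EReal) (Φ : ℝ → ℝ × ℝ → ℝ × ℝ) (t : ℝ) : ℝ :=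
  ∫ a in Icc (-1 : ℝ) 1, speed T Φ (t, (a, 2))

/-- The area of one period of the fluid domain, as a boundary integral. -/
def fluidArea (T : EReal) (Φ : ℝ → ℝ × ℝ → ℝ × ℝ) (t : ℝ) : ℝ :=
  ∫ a in Icc (-1 : ℝ) 1, (dx T (flow Φ) (t, (a, 2))).1 * (flow Φ (t, (a, 2))).2

theorem integral_Icc_eq {f : ℝ → ℝ} :
    ∫ a in Icc (-1 : ℝ) 1, f a = ∫ a in (-1 : ℝ)..1, f a := by
  rw [integral_Icc_eq_integral_Ioc, intervalIntegral.integral_of_le (by norm_num)]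

/-- Mean value theorem: the derivative is needed only at positive times, where the evolution
equations are imposed, and continuity covers time `0`. -/
theorem eq_zero_of_hasDerivAt_zero {T : EReal} {f : ℝ → ℝ}
    (hc : ∀ t ∈ timeInterval T, ContinuousOn f (Icc 0 t))
    (hd : ∀ t, timeInterval T ∈ 𝓝 t → HasDerivAt f 0 t) {t : ℝ} (ht : t ∈ timeInterval T) :
    f t = f 0 := by
  rcases ht.1.eq_or_lt with h0 | h0
  · rw [← h0]
  obtain ⟨c, hc', hcd⟩ := exists_hasDerivAt_eq_slope f (fun _ => 0) h0 (hc t ht) fun s hs =>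
    hd s (timeInterval_mem_nhds (Icc_subset_timeInterval ht ⟨hs.1.le, hs.2.le⟩) hs.1)
  have : t - 0 ≠ 0 := by linarith
  field_simp at hcd
  linarith

namespace IsSolution

variable {σ : ℝ} {T : EReal} {Φ : ℝ → ℝ × ℝ → ℝ × ℝ} {u : ℝ → ℝ × ℝ → ℝ × ℝ} {p : ℝ → ℝ × ℝ → ℝ}

theorem energyDensity_continuousOn (h : IsSolution σ T Φ u p) (hT : 0 < T) :
    ContinuousOn (energyDensity T Φ u) (slab T) :=
  (continuousOn_const.mul (continuousOn_dot h.vel_contDiffOn.continuousOn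
    h.vel_contDiffOn.continuousOn)).mul (h.movingDomain.jac_contDiffOn hT).continuousOn

theorem energyDensityDeriv_continuousOn (h : IsSolution σ T Φ u p) (hT : 0 < T) :
    ContinuousOn (energyDensityDeriv T Φ u) (slab T) := by
  have hm := h.movingDomain
  have hU := h.vel_contDiffOn.continuousOn
  have hU' : ContinuousOn (dt T (vel Φ u)) (slab T) :=
    continuousOn_pd (uniqueDiffOn_slab hT) h.vel_contDiffOn _
  have hW2 : ContinuousOn (dy T (dt T (flow Φ))) (slab T) :=
    continuousOn_pd (uniqueDiffOn_slab hT) (hm.dt_contDiffOn hT) _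
  exact ((continuousOn_dot hU hU').mul (hm.jac_contDiffOn hT).continuousOn).add
    ((continuousOn_const.mul (continuousOn_dot hU hU)).mul
      ((continuousOn_cross (hm.dx_dt_continuousOn hT) (hm.dy_contDiffOn hT).continuousOn).add
        (continuousOn_cross (hm.dx_contDiffOn hT).continuousOn hW2)))

/-- Conservation of energy. -/
theorem energy_add_length (h : IsSolution σ T Φ u p) {t : ℝ} (ht : t ∈ timeInterval T) :
    (∫ x in cell, energyDensity T Φ u (t, x)) + σ * surfaceLength T Φ t =
      (∫ x in cell, energyDensity T Φ u (0, x)) + σ * surfaceLength T Φ 0 := by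
  have hT := pos_of_mem_timeInterval ht
  have hm := h.movingDomain
  refine eq_zero_of_hasDerivAt_zero (T := T)
    (f := fun t => (∫ x in cell, energyDensity T Φ u (t, x)) + σ * surfaceLength T Φ t) ?_ ?_ ht
  · intro s hs
    have hsub := Icc_subset_timeInterval hs
    exact (continuousOn_setIntegral isCompact_Icc isCompact_cell measurableSet_cell
      ((h.energyDensity_continuousOn hT).mono (prod_mono hsub cell_subset))).add
      (continuousOn_const.mul (continuousOn_setIntegral (f := fun r : ℝ × ℝ =>
        speed T Φ (r.1, (r.2, 2))) isCompact_Icc isCompact_Icc measurableSet_Icc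
        ((IsMovingDomain.continuousOn_top (hm.speed_continuousOn hT)).mono
          (prod_mono hsub le_rfl))))
  · intro s hs
    have hsI := mem_of_mem_nhds hs
    have h1 := hasDerivAt_setIntegral (μ := volume) isCompact_cell measurableSet_cell
      ((h.energyDensity_continuousOn hT).mono (prod_mono le_rfl cell_subset))
      ((h.energyDensityDeriv_continuousOn hT).mono (prod_mono le_rfl cell_subset))
      (fun r hr x hx => h.hasDerivAt_energyDensity hr (cell_subset hx)) hs
    have h2 := hasDerivAt_setIntegral (μ := volume) (K := Icc (-1 : ℝ) 1) isCompact_Icc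
      measurableSet_Icc
      (IsMovingDomain.continuousOn_top (hm.speed_continuousOn hT))
      (IsMovingDomain.continuousOn_top (hm.speedDeriv_continuousOn hT))
      (fun r hr a _ => hm.hasDerivAt_speed hr (mem_closedStrip_top a)) hs
    refine (h1.add (h2.const_mul σ)).congr_deriv ?_
    simp only [integral_Icc_eq]
    rw [h.integral_energyDensityDeriv hs, hm.integral_speedDeriv hsI,
      ← intervalIntegral.integral_const_mul]
    simp only [mul_assoc]
    exact neg_add_cancel _

/-- Conservation of area. -/
theorem fluidArea_eq (h : IsSolution σ T Φ u p) {t : ℝ} (ht : t ∈ timeInterval T) :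
    fluidArea T Φ t = fluidArea T Φ 0 := by
  have hT := pos_of_mem_timeInterval ht
  have hm := h.movingDomain
  have hA := (hm.dx_contDiffOn hT).continuousOn
  have hW := (hm.dt_contDiffOn hT).continuousOn
  have hX := hm.flow_contDiffOn.continuousOn
  have hf : ContinuousOn (fun q => (dx T (flow Φ) q).1 * (flow Φ q).2) (slab T) :=
    hA.fst.mul hX.snd
  have hg : ContinuousOn (fun q => (dx T (dt T (flow Φ)) q).1 * (flow Φ q).2 +
      (dx T (flow Φ) q).1 * (dt T (flow Φ) q).2) (slab T) :=
    ((hm.dx_dt_continuousOn hT).fst.mul hX.snd).add (hA.fst.mul hW.snd)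
  refine eq_zero_of_hasDerivAt_zero (T := T) (f := fluidArea T Φ) ?_ ?_ ht
  · intro s hs
    exact continuousOn_setIntegral (f := fun r : ℝ × ℝ => (dx T (flow Φ) (r.1, (r.2, 2))).1 *
      (flow Φ (r.1, (r.2, 2))).2) isCompact_Icc isCompact_Icc measurableSet_Icc
      ((IsMovingDomain.continuousOn_top hf).mono
        (prod_mono (Icc_subset_timeInterval hs) le_rfl))
  · intro s hs
    have hsI := mem_of_mem_nhds hs
    have hb : (2 : ℝ) ∈ Icc (0 : ℝ) 2 := ⟨by norm_num, le_rfl⟩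
    refine (hasDerivAt_setIntegral (μ := volume) (K := Icc (-1 : ℝ) 1) isCompact_Icc
      measurableSet_Icc (IsMovingDomain.continuousOn_top hf)
      (IsMovingDomain.continuousOn_top hg) (fun r hr a _ => ?_) hs).congr_deriv ?_
    · have hq : (r, ((a, 2) : ℝ × ℝ)) ∈ slab T := ⟨mem_of_mem_nhds hr, mem_closedStrip_top a⟩
      have h1 := hasDerivAt_dt (hm.dx_contDiffOn hT) hr (mem_closedStrip_top a)
      rw [dt_dx_flow hm hT hq] at h1
      exact (hasDerivAt_fst h1).mul
        (hasDerivAt_snd (hasDerivAt_dt hm.flow_contDiffOn_one hr (mem_closedStrip_top a)))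
    -- Integration by parts: the rate of `x' y` is the derivative along the curve of the periodic
    -- function `W₁ y` plus `cross A W`. The latter equals `cross A U`, whose integral is the
    -- vanishing flux.
    · have hd : ∀ a : ℝ, HasDerivAt (fun a => (dt T (flow Φ) (s, (a, 2))).1 *
          (flow Φ (s, (a, 2))).2) ((dx T (dt T (flow Φ)) (s, (a, 2))).1 * (flow Φ (s, (a, 2))).2 +
          (dt T (flow Φ) (s, (a, 2))).1 * (dx T (flow Φ) (s, (a, 2))).2) a := fun a =>
        (hasDerivAt_fst (hasDerivAt_dx (hm.dt_contDiffOn hT) hsI hb a)).mul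
          (hasDerivAt_snd (hasDerivAt_dx hm.flow_contDiffOn_one hsI hb a))
      have hi : IntervalIntegrable (fun a => (dx T (dt T (flow Φ)) (s, (a, 2))).1 *
          (flow Φ (s, (a, 2))).2 + (dt T (flow Φ) (s, (a, 2))).1 *
          (dx T (flow Φ) (s, (a, 2))).2) volume (-1) 1 :=
        (IsMovingDomain.continuous_top (((hm.dx_dt_continuousOn hT).fst.mul hX.snd).add
          (hW.fst.mul hA.snd)) hsI).intervalIntegrable _ _
      have hj : IntervalIntegrable (fun a => cross (dx T (flow Φ) (s, (a, 2)))
          (vel Φ u (s, (a, 2)))) volume (-1) 1 :=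
        (IsMovingDomain.continuous_top (continuousOn_cross hA h.vel_contDiffOn.continuousOn)
          hsI).intervalIntegrable _ _
      have ftc := intervalIntegral.integral_eq_sub_of_hasDerivAt (fun a _ => hd a) hi
      have hend := hm.top_add_period hsI (-1) (1, 0)
      have hend' := hm.flow_top_add_period hsI (-1)
      norm_num at hend hend'
      rw [show dt T (flow Φ) (s, (1, 2)) = dt T (flow Φ) (s, (-1, 2)) from hend, hend'] at ftc
      have hflux := h.integral_cross_vel hs
      have hsum := intervalIntegral.integral_add hi hj
      rw [ftc, hflux] at hsum
      simp only [integral_Icc_eq]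
      rw [← show _ = (0 : ℝ) from hsum.trans (by simp)]
      refine intervalIntegral.integral_congr fun a _ => ?_
      have e := h.cross_dt_eq hs a
      simp only [cross] at e ⊢
      linear_combination e

end IsSolution

/-! ### The height estimate for short curves -/

/-- A plane curve `(x, y)` of horizontal period `2` and length at most `41/20` which encloses the area
`4` with the bottom stays within `1/2` of height `2`. -/
theorem abs_height_sub_two_lt {x' y y' : ℝ → ℝ} (hx : Continuous x') (hy : Continuous y')
    (hd : ∀ a, HasDerivAt y (y' a) a) (hper : ∫ a in (-1 : ℝ)..1, x' a = 2)
    (harea : ∫ a in (-1 : ℝ)..1, x' a * y a = 4)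
    (hlen : ∫ a in (-1 : ℝ)..1, √(x' a * x' a + y' a * y' a) ≤ 41 / 20)
    {b : ℝ} (hb : b ∈ Icc (-1 : ℝ) 1) : |y b - 2| < 1 / 2 := by
  have hyc : Continuous y := continuous_iff_continuousAt.2 fun a => (hd a).continuousAt
  have hle : (-1 : ℝ) ≤ 1 := by norm_num
  have hs : Continuous fun a => √(x' a * x' a + y' a * y' a) :=
    ((hx.mul hx).add (hy.mul hy)).sqrt
  set L := ∫ a in (-1 : ℝ)..1, √(x' a * x' a + y' a * y' a) with hL
  set V := ∫ a in (-1 : ℝ)..1, |y' a| with hV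
  have hV0 : 0 ≤ V := intervalIntegral.integral_nonneg hle fun _ _ => abs_nonneg _
  have hVle : V ≤ 9 / 20 := by
    -- Cauchy–Schwarz against the unit vector `(40/41, 9/41)`, the direction of `(2, 9/20)`, whose
    -- length is exactly `41/20`; thus the bound on `V` is sharp.
    have h1 : ∫ a in (-1 : ℝ)..1, (40 / 41 * x' a + 9 / 41 * |y' a|) ≤ L := by
      refine intervalIntegral.integral_mono_on hle
        ((by fun_prop : Continuous _).intervalIntegrable _ _) (hs.intervalIntegrable _ _)
        fun a _ => Real.le_sqrt_of_sq_le ?_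
      nlinarith [sq_nonneg (9 * x' a - 40 * |y' a|), abs_mul_abs_self (y' a)]
    rw [intervalIntegral.integral_add ((by fun_prop : Continuous _).intervalIntegrable _ _)
      ((by fun_prop : Continuous _).intervalIntegrable _ _),
      intervalIntegral.integral_const_mul, intervalIntegral.integral_const_mul, hper] at h1
    linarith
  have hosc : ∀ a ∈ Icc (-1 : ℝ) 1, |y a - y b| ≤ V := by
    intro a ha
    rw [← intervalIntegral.integral_eq_sub_of_hasDerivAt (fun c _ => hd c)
      (hy.intervalIntegrable b a)]
    refine (intervalIntegral.norm_integral_le_abs_integral_norm (f := y')).trans ?_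
    simp only [Real.norm_eq_abs]
    rw [← abs_of_nonneg hV0, hV]
    refine intervalIntegral.abs_integral_mono_interval ?_ ?_ (hy.abs.intervalIntegrable _ _)
    · rw [uIoc_of_le hle]
      exact Ioc_subset_Ioc (le_min hb.1 ha.1) (max_le hb.2 ha.2)
    · exact Eventually.of_forall fun _ => abs_nonneg _
  have hkey : |∫ a in (-1 : ℝ)..1, x' a * (y a - y b)| ≤ ∫ a in (-1 : ℝ)..1,
      √(x' a * x' a + y' a * y' a) * V := by
    refine (intervalIntegral.abs_integral_le_integral_abs hle).trans
      (intervalIntegral.integral_mono_on hle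
        ((by fun_prop : Continuous _).intervalIntegrable _ _)
        ((hs.mul_const V).intervalIntegrable _ _) fun a ha => ?_)
    rw [abs_mul]
    refine mul_le_mul (Real.abs_le_sqrt ?_) (hosc a ha) (abs_nonneg _) (Real.sqrt_nonneg _)
    nlinarith [mul_self_nonneg (y' a)]
  have heq : ∫ a in (-1 : ℝ)..1, x' a * (y a - y b) = 4 - 2 * y b := by
    simp only [mul_sub]
    rw [intervalIntegral.integral_sub (f := fun a => x' a * y a)
      ((hx.mul hyc).intervalIntegrable _ _) ((hx.mul_const _).intervalIntegrable _ _), intervalIntegral.integral_mul_const, hper, harea]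
  rw [heq, intervalIntegral.integral_mul_const, ← hL] at hkey
  have hLV : L * V ≤ 41 / 20 * (9 / 20) := mul_le_mul hlen hVle hV0 (by norm_num)
  rw [abs_lt]
  -- Here `|4 - 2 y b| ≤ 369/400 < 1`.
  constructor <;> linarith [(abs_le.1 hkey).1, (abs_le.1 hkey).2]

/-! ### Length and area bounds, and the conclusion -/

namespace IsMovingDomain

variable {T : EReal} {Φ : ℝ → ℝ × ℝ → ℝ × ℝ}

theorem integral_dx_fst (h : IsMovingDomain T Φ) {t : ℝ} (ht : t ∈ timeInterval T) :
    ∫ a in (-1 : ℝ)..1, (dx T (flow Φ) (t, (a, 2))).1 = 2 := by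
  have hT := pos_of_mem_timeInterval ht
  rw [intervalIntegral.integral_eq_sub_of_hasDerivAt (fun a _ => hasDerivAt_fst
    (hasDerivAt_dx h.flow_contDiffOn_one ht (b := 2) ⟨by norm_num, le_rfl⟩ a))
    ((continuous_top (h.dx_contDiffOn hT).continuousOn ht).fst.intervalIntegrable _ _)]
  have := h.flow_top_add_period ht (-1)
  norm_num at this
  rw [this]
  simp

theorem two_le_surfaceLength (h : IsMovingDomain T Φ) {t : ℝ} (ht : t ∈ timeInterval T) :
    2 ≤ surfaceLength T Φ t := by
  have hT := pos_of_mem_timeInterval ht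
  rw [surfaceLength, integral_Icc_eq]
  refine (h.integral_dx_fst ht).symm.le.trans <| intervalIntegral.integral_mono_on (by norm_num)
    ((continuous_top (h.dx_contDiffOn hT).continuousOn ht).fst.intervalIntegrable _ _)
    ((continuous_top (h.speed_continuousOn hT) ht).intervalIntegrable _ _) fun a _ =>
    Real.le_sqrt_of_sq_le ?_
  simp only [dot]
  nlinarith [mul_self_nonneg (dx T (flow Φ) (t, (a, 2))).2]

theorem surfaceLength_zero (h : IsMovingDomain T Φ) (hT : 0 < T) : surfaceLength T Φ 0 = 2 := by
  simp only [surfaceLength, speed, h.dx_flow_zero hT (mem_closedStrip_top _), dot]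
  norm_num

theorem fluidArea_zero (h : IsMovingDomain T Φ) (hT : 0 < T) : fluidArea T Φ 0 = 4 := by
  simp only [fluidArea, flow, h.dx_flow_zero hT (mem_closedStrip_top _),
    h.initial _ (mem_closedStrip_top _)]
  norm_num

end IsMovingDomain

namespace IsSolution

variable {σ : ℝ} {T : EReal} {Φ : ℝ → ℝ × ℝ → ℝ × ℝ} {u : ℝ → ℝ × ℝ → ℝ × ℝ} {p : ℝ → ℝ × ℝ → ℝ}

/-- Links the energy over a period cell of the moving domain to the integral over the fixed cell,
the one that can be differentiated in time. -/
theorem kineticEnergy_eq (h : IsSolution σ T Φ u p) {t : ℝ} (ht : t ∈ timeInterval T) :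
    kineticEnergy (fluidDomain Φ t) (u t) = ∫ x in cell, energyDensity T Φ u (t, x) := by
  have hm := h.movingDomain
  have hT := pos_of_mem_timeInterval ht
  rw [kineticEnergy, fluidDomain, setIntegral_image_strip ((hm.injOn t ht).mono strip_subset)
    (fun x hx => hm.periodic t ht x (strip_subset hx)) (fun x hx => hm.hasFDerivAt_space ht hx)
    (fun y hy => by rw [h.velocity_periodic t ht y (subset_closure hy)]), ← integral_const_mul]
  refine setIntegral_congr_fun measurableSet_cell fun x hx => ?_
  have hj : ((fderivWithin ℝ (flow Φ) (slab T) (t, x)).comp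
      (ContinuousLinearMap.inr ℝ ℝ (ℝ × ℝ))).det = jac T Φ (t, x) := det_prod _
  have hpos := hm.jac_pos hT (q := (t, x)) ⟨ht, cell_subset hx⟩
  simp only [hj, abs_of_pos hpos, energyDensity, vel]
  ring

theorem kineticEnergy_add_length (h : IsSolution σ T Φ u p) {t : ℝ} (ht : t ∈ timeInterval T) :
    kineticEnergy (fluidDomain Φ t) (u t) + σ * surfaceLength T Φ t =
      kineticEnergy (fluidDomain Φ 0) (u 0) + σ * 2 := by
  have hT := pos_of_mem_timeInterval ht
  have := h.energy_add_length ht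
  rwa [← h.kineticEnergy_eq ht, ← h.kineticEnergy_eq (zero_mem_timeInterval hT),
    h.movingDomain.surfaceLength_zero hT] at this

theorem kineticEnergy_le (h : IsSolution σ T Φ u p) (hσ : 0 < σ) {t : ℝ}
    (ht : t ∈ timeInterval T) :
    kineticEnergy (fluidDomain Φ t) (u t) ≤ kineticEnergy (fluidDomain Φ 0) (u 0) := by
  have h1 := h.kineticEnergy_add_length ht
  have h2 := mul_le_mul_of_nonneg_left (h.movingDomain.two_le_surfaceLength ht) hσ.le
  linarith

theorem surfaceLength_le (h : IsSolution σ T Φ u p) (hσ : 0 < σ)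
    (hK : kineticEnergy (fluidDomain Φ 0) (u 0) ≤ σ / 20) {t : ℝ} (ht : t ∈ timeInterval T) :
    surfaceLength T Φ t ≤ 41 / 20 := by
  have h1 := h.kineticEnergy_add_length ht
  have h2 : 0 ≤ kineticEnergy (fluidDomain Φ t) (u t) :=
    mul_nonneg (by norm_num) (integral_nonneg fun x =>
      add_nonneg (mul_self_nonneg _) (mul_self_nonneg _))
  refine le_of_mul_le_mul_left ?_ hσ
  linarith

theorem freeBoundary_subset (h : IsSolution σ T Φ u p) (hσ : 0 < σ)
    (hK : kineticEnergy (fluidDomain Φ 0) (u 0) ≤ σ / 20) {t : ℝ} (ht : t ∈ timeInterval T) :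
    freeBoundary Φ t ⊆ {x | 3 / 2 < x.2 ∧ x.2 < 5 / 2} := by
  have hm := h.movingDomain
  have hT := pos_of_mem_timeInterval ht
  have hA := IsMovingDomain.continuous_top (hm.dx_contDiffOn hT).continuousOn ht
  rintro _ ⟨a, rfl⟩
  -- The shift is horizontal, so the height is periodic and one period of parameters suffices.
  have hper : Function.Periodic (fun a : ℝ => (flow Φ (t, (a, 2))).2) 2 := fun a => by
    simp [hm.flow_top_add_period ht]
  obtain ⟨b, hb, hab⟩ := hper.exists_mem_Ico two_pos a (-1)
  have hb' : b ∈ Icc (-1 : ℝ) 1 := ⟨hb.1, by linarith [hb.2]⟩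
  have hlen := h.surfaceLength_le hσ hK ht
  have harea := (h.fluidArea_eq ht).trans (hm.fluidArea_zero hT)
  rw [surfaceLength, integral_Icc_eq] at hlen
  rw [fluidArea, integral_Icc_eq] at harea
  have key := abs_height_sub_two_lt hA.fst hA.snd (fun a => hasDerivAt_snd
    (hasDerivAt_dx hm.flow_contDiffOn_one ht (b := 2) ⟨by norm_num, le_rfl⟩ a))
    (hm.integral_dx_fst ht) harea hlen hb'
  rw [← hab, abs_lt] at key
  change 3 / 2 < (flow Φ (t, (a, 2))).2 ∧ (flow Φ (t, (a, 2))).2 < 5 / 2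
  constructor <;> linarith [key.1, key.2]

end IsSolution

end CapillaryWaves

end

theorem proposition3p1 (σ : ℝ) (hσ : 0 < σ) (T : EReal) (hT : 0 < T)
    (Φ : ℝ → ℝ × ℝ → ℝ × ℝ) (u : ℝ → ℝ × ℝ → ℝ × ℝ) (p : ℝ → ℝ × ℝ → ℝ)
    (hsol : CapillaryWaves.IsSolution σ T Φ u p)
    (hsmooth : ContDiffOn ℝ ∞ (u 0) (CapillaryWaves.fluidDomain Φ 0))
    (hK : CapillaryWaves.kineticEnergy (CapillaryWaves.fluidDomain Φ 0) (u 0) ≤ σ / 20) :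
    (∀ t ∈ CapillaryWaves.timeInterval T,
      CapillaryWaves.freeBoundary Φ t ⊆ {x | 3 / 2 < x.2 ∧ x.2 < 5 / 2}) ∧
    (∀ t ∈ CapillaryWaves.timeInterval T,
      CapillaryWaves.kineticEnergy (CapillaryWaves.fluidDomain Φ t) (u t) ≤
        CapillaryWaves.kineticEnergy (CapillaryWaves.fluidDomain Φ 0) (u 0)) :=
  ⟨fun _ ht => hsol.freeBoundary_subset hσ hK ht, fun _ ht => hsol.kineticEnergy_le hσ ht⟩
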